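/- A quantitative game $\mathcal G=(\Pi,V,(V_i)_{i\in\Pi},E,\bar\lambda)$ consists of a finite set $\Pi$ of players, a finite set $V$ of vertices partitioned into the sets $V_i$ of vertices controlled by player $i$, a set $E\subseteq V\times V$ of edges such that every vertex has a successor, and cost functions $\lambda_i:V^\omega\to\mathbb R\cup\{+\infty\}$. A play is an infinite path of $(V,E)$, a history a non-empty finite path; a play or history of $(\mathcal G,v_0)$ is one that starts in $v_0$. A strategy $\sigma_i$ of player $i$ in $(\mathcal G,v_0)$ maps each history $hv$ of $(\mathcal G,v_0)$ with last vertex $v\in V_i$ to a successor of $v$; it is finite-memory if it is computed by a finite Moore machine that reads the history. The outcome $\langle\bar\sigma\rangle_{v_0}$ of a strategy profile $\bar\sigma=(\sigma_i)_{i\in\Pi}$ is the play from $v_0$ consistent with all $\sigma_i$; the profile is finite-memory if all $\sigma_i$ are. A strategy $\sigma_i'$ of player $i$ is finitely deviating from $\bar\sigma$ if $\sigma_i'(hv)\neq\sigma_i(hv)$ for only finitely many prefixes $hv$, $v\in V_i$, of $\langle\sigma'_i,\sigma_{-i}\rangle_{v_0}$. The profile $\bar\sigma$ is a weak Nash equilibrium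 in $(\mathcal G,v_0)$ if $\lambda_i(\langle\sigma'_i,\sigma_{-i}\rangle_{v_0})\ge\lambda_i(\langle\bar\sigma\rangle_{v_0})$ for all $i\in\Pi$ and all finitely deviating $\sigma'_i$. It is a weak subgame perfect equilibrium (weak SPE) in $(\mathcal G,v_0)$ if for every history $hv$ of $(\mathcal G,v_0)$ the profile $\bar\sigma_{|h}$, $\sigma_{i|h}(h')=\sigma_i(hh')$, is a weak Nash equilibrium in the game $(\mathcal G_{|h},v)$ with the same graph and with cost functions $\rho\mapsto\lambda_i(h\rho)$. **Theorem.** Consider initialized games $(\mathcal G,v_0)$ such that, for every $i\in\Pi$, * $\lambda_i$ is prefix-independent on plays, i.e. $\lambda_i(h\rho)=\lambda_i(\rho)$ whenever $h\rho$ is a play, and the set $C_i$ of values of $\lambda_i$ on plays is a finite set of rational numbers; * for all $c\in C_i$ and $v\in V$, the set of plays $\rho$ from $v$ with $\lambda_i(\rho)=c$ is $\omega$-regular (recognized by a finite Büchi automaton). Such a game is given to an algorithm by its finite graph, the owners of the vertices, the initial vertex, and, for each player $i$, a finite list of rational numbers that contains $C_i$, together with, for each listed number $c$ and each $v\in V$,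 a Büchi automaton recognizing the set of plays $\rho$ from $v$ with $\lambda_i(\rho)=c$; every game of the class can be given in this way. Then, uniformly in the game: 1. there are an algorithm that decides whether $(\mathcal G,v_0)$ has a weak SPE, and an algorithm that, if there is one, outputs Moore machines, one for each player, describing a finite-memory weak SPE in $(\mathcal G,v_0)$; 2. there are an algorithm that, given in addition rational numbers $c_i$, $i\in\Pi$ (in particular $c_i\in C_i$), decides whether $(\mathcal G,v_0)$ has a weak SPE $\bar\sigma$ with $\lambda_i(\langle\bar\sigma\rangle_{v_0})\le c_i$ for all $i\in\Pi$, and an algorithm that, if there is one, outputs Moore machines describing such a finite-memory weak SPE. -/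

import Mathlib

open Filter

/-! ## Quantitative games -/

/-- The data of a quantitative game with set of players `P` and set of vertices `V`.
The partition of the vertices is given by the map `owner`; every vertex has a successor; costs
lie in `ℝ ∪ {+∞}`. Finiteness of `P` and `V` is assumed where games are used. -/
structure QuantGame (P : Type*) (V : Type*) where
  owner : V → P
  edge : V → V → Prop
  exists_edge : ∀ v, ∃ v', edge v v'
  cost : P → (ℕ → V) → WithTop ℝ

/-- The infinite word `hρ`. -/
def prepend {V : Type*} (h : List V) (ρ : ℕ → V) : ℕ → V :=
  fun n => h.getD n (ρ (n - h.length))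

/-- A (total) function on pairs `(h, v)`, standing for a function on histories `hv`. -/
abbrev Move (V : Type*) := List V → V → V

namespace QuantGame

variable {P V : Type*}

/-- The infinite word `ρ` is a play. -/
def IsPlay (G : QuantGame P V) (ρ : ℕ → V) : Prop := ∀ n, G.edge (ρ n) (ρ (n + 1))

/-- `h` is a (non-empty) history that starts in `v₀`. -/
def IsHist (G : QuantGame P V) (v₀ : V) (h : List V) : Prop :=
  h.head? = some v₀ ∧ h.IsChain G.edge

/-- `σ` is a strategy of player `i` in the game initialized at `v₀`. Only the values `σ h v` with
`hv` a history from `v₀` that ends in a vertex `v` of player `i` are meaningful. -/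
def IsStrategy (G : QuantGame P V) (v₀ : V) (i : P) (σ : Move V) : Prop :=
  ∀ h v, G.IsHist v₀ (h ++ [v]) → G.owner v = i → G.edge v (σ h v)

/-- `σ` is a strategy profile in the game initialized at `v₀`. -/
def IsProfile (G : QuantGame P V) (v₀ : V) (σ : P → Move V) : Prop :=
  ∀ i, G.IsStrategy v₀ i (σ i)

/-- The first `n + 1` vertices of the outcome of `σ` from `v₀`, as a pair `(h, v)` that stands for
the history `hv`. -/
def outcomeHist (G : QuantGame P V) (σ : P → Move V) (v₀ : V) : ℕ → List V × V
  | 0 => ([], v₀)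
  | n + 1 =>
    let p := outcomeHist G σ v₀ n
    (p.1 ++ [p.2], σ (G.owner p.2) p.1 p.2)

/-- The outcome of the profile `σ` from `v₀`. -/
def outcome (G : QuantGame P V) (σ : P → Move V) (v₀ : V) : ℕ → V :=
  fun n => (G.outcomeHist σ v₀ n).2

open Classical in
/-- The profile `(σ'_i, σ_{-i})`. -/
noncomputable def deviate (σ : P → Move V) (i : P) (σ' : Move V) : P → Move V :=
  Function.update σ i σ'

/-- The strategy `σ'` of player `i` has an `hv`-deviation step from the profile `σ`:
the vertex `v` belongs to player `i`, the history `hv` is a prefix of the outcome of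
`(σ'_i, σ_{-i})`, and `σ'` and `σ_i` differ on `hv`. -/
def DeviationStep (G : QuantGame P V) (v₀ : V) (σ : P → Move V) (i : P) (σ' : Move V)
    (h : List V) (v : V) : Prop :=
  G.owner v = i ∧
  h ++ [v] = (List.range (h.length + 1)).map (G.outcome (deviate σ i σ') v₀) ∧
  σ i h v ≠ σ' h v

/-- `σ'` has finitely many deviation steps from `σ`. -/
def FinitelyDeviating (G : QuantGame P V) (v₀ : V) (σ : P → Move V) (i : P) (σ' : Move V) : Prop :=
  {p : List V × V | G.DeviationStep v₀ σ i σ' p.1 p.2}.Finite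

/-- `σ` is a weak Nash equilibrium in the game initialized at `v₀`. -/
def IsWeakNE (G : QuantGame P V) (v₀ : V) (σ : P → Move V) : Prop :=
  G.IsProfile v₀ σ ∧
  ∀ (i : P) (σ' : Move V), G.IsStrategy v₀ i σ' → G.FinitelyDeviating v₀ σ i σ' →
    G.cost i (G.outcome σ v₀) ≤ G.cost i (G.outcome (deviate σ i σ') v₀)

/-- The game with the same graph and with costs `ρ ↦ λ(hρ)`. -/
def subgame (G : QuantGame P V) (h : List V) : QuantGame P V where
  owner := G.owner
  edge := G.edge
  exists_edge := G.exists_edge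
  cost := fun i ρ => G.cost i (prepend h ρ)

/-- The profile induced by `σ` after `h`. -/
def shift (σ : P → Move V) (h : List V) : P → Move V := fun i h' v' => σ i (h ++ h') v'

/-- `σ` is a weak subgame perfect equilibrium in the game initialized at `v₀`. -/
def IsWeakSPE (G : QuantGame P V) (v₀ : V) (σ : P → Move V) : Prop :=
  G.IsProfile v₀ σ ∧
  ∀ h v, G.IsHist v₀ (h ++ [v]) → (G.subgame h).IsWeakNE v (shift σ h)

/-- The cost function of player `i` is prefix-independent (on plays). -/
def PrefixIndependent (G : QuantGame P V) (i : P) : Prop :=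
  ∀ (h : List V) (ρ : ℕ → V), G.IsPlay (prepend h ρ) → G.cost i (prepend h ρ) = G.cost i ρ

/-- The set of costs that player `i` can pay in plays. -/
def costRange (G : QuantGame P V) (i : P) : Set (WithTop ℝ) := G.cost i '' {ρ | G.IsPlay ρ}

/-- The set of plays from `v` with cost `c` for player `i`. -/
def levelSet (G : QuantGame P V) (i : P) (c : WithTop ℝ) (v : V) : Set (ℕ → V) :=
  {ρ | G.IsPlay ρ ∧ ρ 0 = v ∧ G.cost i ρ = c}

end QuantGame

/-- A rational number as a possible cost. -/
noncomputable def ratCost (q : ℚ) : WithTop ℝ := ((q : ℝ) : WithTop ℝ)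

/-! ## Omega-regular sets and finite-memory strategies -/

/-- Acceptance of an infinite word by a nondeterministic automaton with the Büchi condition. -/
def BuchiAccepts {A S : Type*} (M : NFA A S) (w : ℕ → A) : Prop :=
  ∃ r : ℕ → S, r 0 ∈ M.start ∧ (∀ n, r (n + 1) ∈ M.step (r n) (w n)) ∧
    ∃ᶠ n in atTop, r n ∈ M.accept

/-- `L` is recognized by a Büchi automaton with finitely many states. -/
def OmegaRegular {A : Type*} (L : Set (ℕ → A)) : Prop :=
  ∃ (k : ℕ) (M : NFA A (Fin k)), L = {w | BuchiAccepts M w}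

/-- The class of games considered: the cost functions are prefix-independent, have a finite range
of rational numbers, and have omega-regular level sets. -/
structure QuantGame.IsRegularPrefixIndependent {P V : Type*} (G : QuantGame P V) : Prop where
  prefixIndependent : ∀ i, G.PrefixIndependent i
  finite_range : ∀ i, (G.costRange i).Finite
  rational_range : ∀ i, G.costRange i ⊆ Set.range ratCost
  omegaRegular : ∀ i, ∀ c ∈ G.costRange i, ∀ v, OmegaRegular (G.levelSet i c v)

/-- A Moore machine with set of states `S` that reads vertices and outputs vertices. -/
structure MooreMachine (V S : Type*) where
  init : S
  update : S → V → S
  output : S → V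

/-- The output of a Moore machine after reading a finite word. -/
def MooreMachine.eval {V S : Type*} (M : MooreMachine V S) (h : List V) : V :=
  M.output (h.foldl M.update M.init)

/-- The Moore machine `M` computes the strategy `σ` of player `i` in the game initialized
at `v₀`. -/
def MooreMachine.Computes {P V S : Type*} (M : MooreMachine V S) (G : QuantGame P V) (v₀ : V)
    (i : P) (σ : Move V) : Prop :=
  ∀ h v, G.IsHist v₀ (h ++ [v]) → G.owner v = i → σ h v = M.eval (h ++ [v])

/-! ## Finite codes for the inputs and outputs of algorithms

Players, vertices and states are numbered from `0`. -/

/-- The code of the rational number `(pos - neg) / (den + 1)`. -/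
structure RatCode where
  pos : ℕ
  neg : ℕ
  den : ℕ

def RatCode.value (q : RatCode) : ℚ := ((q.pos : ℚ) - (q.neg : ℚ)) / ((q.den : ℚ) + 1)

/-- The code of a Büchi automaton: the number of states, the initial states, the accepting states,
and the transitions (source, letter, target). -/
structure BuchiCode where
  states : ℕ
  start : List ℕ
  accept : List ℕ
  trans : List (ℕ × ℕ × ℕ)

/-- The automaton with a given code, over an alphabet whose letters are numbered by `ν`. -/
def BuchiCode.toNFA {V : Type*} (c : BuchiCode) (ν : V → ℕ) : NFA V (Fin c.states) where
  step s a := {t | ((s : ℕ), ν a, (t : ℕ)) ∈ c.trans}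
  start := {s | (s : ℕ) ∈ c.start}
  accept := {s | (s : ℕ) ∈ c.accept}

/-- The code of a Moore machine: the number of states, the initial state, the table of the update
function (one row per state, one column per vertex), and the list of the outputs of the states. -/
structure MooreCode where
  states : ℕ
  init : ℕ
  update : List (List ℕ)
  output : List ℕ

/-- `c` is a code of the Moore machine `M`, when the vertices are numbered by `ν`. -/
def MooreCode.Describes {V : Type*} (c : MooreCode) (ν : V → ℕ)
    (M : MooreMachine V (Fin c.states)) : Prop :=
  c.init = (M.init : ℕ) ∧
  (∀ (s : Fin c.states) (v : V), (c.update[(s : ℕ)]?).bind (fun row => row[ν v]?) = some (M.update s v : ℕ)) ∧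
  (∀ s : Fin c.states, c.output[(s : ℕ)]? = some (ν (M.output s)))

/-- The code of an initialized game: the numbers of players and of vertices, the list of the owners
of the vertices, the edges, the initial vertex, and for each player a list of possible costs, each
with one Büchi automaton for each vertex. -/
structure GameCode where
  players : ℕ
  vertices : ℕ
  owner : List ℕ
  edges : List (ℕ × ℕ)
  init : ℕ
  levels : List (List (RatCode × List BuchiCode))

/-- `c` is a code of the game `G` initialized at `v₀`, when the players are numbered by `π` and the
vertices by `ν`. The costs listed for a player must include all the costs of plays, and
the automaton listed for a cost and a vertex `v` must recognize the plays from `v` with this cost. -/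
structure GameCode.Presents {P V : Type*} (c : GameCode) (G : QuantGame P V) (v₀ : V)
    (π : P ≃ Fin c.players) (ν : V ≃ Fin c.vertices) : Prop where
  owner : ∀ v, c.owner[(ν v : ℕ)]? = some (π (G.owner v) : ℕ)
  edge : ∀ u v, G.edge u v ↔ ((ν u : ℕ), (ν v : ℕ)) ∈ c.edges
  init : c.init = (ν v₀ : ℕ)
  levels : ∀ i, ∃ l, c.levels[(π i : ℕ)]? = some l ∧
    (∀ x ∈ G.costRange i, ∃ e ∈ l, x = ratCost e.1.value) ∧
    (∀ e ∈ l, ∀ v, ∃ b, e.2[(ν v : ℕ)]? = some b ∧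
      G.levelSet i (ratCost e.1.value) v =
        {w | BuchiAccepts (b.toNFA (fun u => (ν u : ℕ))) w})

/-- The list `b` of codes represents the family `q` of rational numbers, one for each player. -/
def RepresentsBounds {P : Type*} {m : ℕ} (b : List RatCode) (π : P ≃ Fin m) (q : P → ℚ) : Prop :=
  ∀ i, ∃ r, b[(π i : ℕ)]? = some r ∧ r.value = q i

/-- The list `out` of codes of (finite) Moore machines represents the strategy profile `σ` of the
game initialized at `v₀`; in particular `σ` is finite-memory. -/
def RepresentsProfile {P V : Type*} {m n : ℕ} (out : List MooreCode) (G : QuantGame P V) (v₀ : V)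
    (π : P ≃ Fin m) (ν : V ≃ Fin n) (σ : P → Move V) : Prop :=
  ∀ i, ∃ c, out[(π i : ℕ)]? = some c ∧
    ∃ M : MooreMachine V (Fin c.states),
      c.Describes (fun u => (ν u : ℕ)) M ∧ M.Computes G v₀ i (σ i)

/-! Codes are tuples and lists of natural numbers, and are coded as such by natural numbers. -/

def RatCode.equiv : RatCode ≃ ℕ × ℕ × ℕ where
  toFun c := (c.pos, c.neg, c.den)
  invFun c := ⟨c.1, c.2.1, c.2.2⟩
  left_inv _ := rfl
  right_inv _ := rfl

instance RatCode.instPrimcodable : Primcodable RatCode := Primcodable.ofEquiv _ RatCode.equiv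

def BuchiCode.equiv : BuchiCode ≃ ℕ × List ℕ × List ℕ × List (ℕ × ℕ × ℕ) where
  toFun c := (c.states, c.start, c.accept, c.trans)
  invFun c := ⟨c.1, c.2.1, c.2.2.1, c.2.2.2⟩
  left_inv _ := rfl
  right_inv _ := rfl

instance BuchiCode.instPrimcodable : Primcodable BuchiCode :=
  Primcodable.ofEquiv _ BuchiCode.equiv

def MooreCode.equiv : MooreCode ≃ ℕ × ℕ × List (List ℕ) × List ℕ where
  toFun c := (c.states, c.init, c.update, c.output)
  invFun c := ⟨c.1, c.2.1, c.2.2.1, c.2.2.2⟩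
  left_inv _ := rfl
  right_inv _ := rfl

instance MooreCode.instPrimcodable : Primcodable MooreCode :=
  Primcodable.ofEquiv _ MooreCode.equiv

def GameCode.equiv : GameCode ≃
    ℕ × ℕ × List ℕ × List (ℕ × ℕ) × ℕ × List (List (RatCode × List BuchiCode)) where
  toFun c := (c.players, c.vertices, c.owner, c.edges, c.init, c.levels)
  invFun c := ⟨c.1, c.2.1, c.2.2.1, c.2.2.2.1, c.2.2.2.2.1, c.2.2.2.2.2⟩
  left_inv _ := rfl
  right_inv _ := rfl

instance GameCode.instPrimcodable : Primcodable GameCode :=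
  Primcodable.ofEquiv _ GameCode.equiv

/-! A weak SPE can be rebuilt from the cost vectors that it produces. Call `(v, p)` realized by `σ`
if the outcome of `σ` after some history ending in `v` has cost vector `p`. By prefix-independence
this outcome is a play from `v` with costs `p`, along which `p` stays realized
(`IsWeakSPE.exists_play`). A deviation in a single step is finite, so every edge from `v` to `w`
leads to a realized `(w, p')` with `p ≤ p'` for the owner of `v` (`IsWeakSPE.exists_deviation`).
Conversely, these two properties suffice: follow a play with the promised costs, and at each
departure from it switch to a promise that does not reward the player who departed. Along a finitely
deviating play the promise to the deviator never decreases, and after the last deviation it is kept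
(`EqMachine.isWeakSPE`).

Promises can be kept with finite memory. In the product of the graph with one Büchi automaton per
player, a play with costs `p` becomes a path in a finite graph that meets one Büchi condition per
player, and with a cyclic counter such paths can be chosen positionally (`exists_positional`). The
reaction to a departure need only depend on the current product node. Hence every weak SPE yields an
equilibrium machine with at most `nodeBound` states and the same outcome costs
(`exists_certifies_of_isWeakSPE`).

The tables of such a machine are the digits of a number below the computable `tablesBound`. Being an
equilibrium machine is a primitive recursive property of that number, since acceptance along
infinite orbits is expressed by a quantifier over the finitely many sets of nodes. Decision and
construction are therefore bounded searches (`exists_computable_search`), and cost bounds are one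
more test, on the labels of the initial node. -/

/-! ## Words, histories and plays -/

/-- The word formed by the first `n` letters of `ρ`. -/
def initialSegment {V : Type*} (ρ : ℕ → V) (n : ℕ) : List V := (List.range n).map ρ

section Words

variable {V : Type*}

@[simp] theorem initialSegment_zero (ρ : ℕ → V) : initialSegment ρ 0 = [] := rfl

theorem initialSegment_succ (ρ : ℕ → V) (n : ℕ) :
    initialSegment ρ (n + 1) = initialSegment ρ n ++ [ρ n] := by
  simp [initialSegment, List.range_succ]

theorem initialSegment_succ' (ρ : ℕ → V) (n : ℕ) :
    initialSegment ρ (n + 1) = ρ 0 :: initialSegment (fun m => ρ (m + 1)) n := by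
  simp [initialSegment, List.range_succ_eq_map, Function.comp_def]

@[simp] theorem length_initialSegment (ρ : ℕ → V) (n : ℕ) : (initialSegment ρ n).length = n := by
  simp [initialSegment]

@[simp] theorem prepend_nil (ρ : ℕ → V) : prepend [] ρ = ρ := by
  funext n; simp [prepend]

@[simp] theorem prepend_cons_zero (a : V) (h : List V) (ρ : ℕ → V) : prepend (a :: h) ρ 0 = a := by
  simp [prepend]

@[simp] theorem prepend_cons_succ (a : V) (h : List V) (ρ : ℕ → V) (n : ℕ) :
    prepend (a :: h) ρ (n + 1) = prepend h ρ n := by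
  simp [prepend]

theorem prepend_initialSegment (ρ : ℕ → V) (n : ℕ) :
    prepend (initialSegment ρ n) (fun m => ρ (n + m)) = ρ := by
  funext m
  by_cases hm : m < n
  · simp [prepend, initialSegment, List.getD, hm]
  · have : n + (m - n) = m := by omega
    simp [prepend, initialSegment, List.getD, hm, this]

end Words

namespace QuantGame

variable {P V : Type*} {G : QuantGame P V}

theorem outcomeHist_fst (σ : P → Move V) (v : V) (n : ℕ) :
    (G.outcomeHist σ v n).1 = initialSegment (G.outcome σ v) n := by
  induction n with
  | zero => rfl
  | succ n ih => rw [initialSegment_succ, ← ih]; rfl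

@[simp] theorem outcome_zero (σ : P → Move V) (v : V) : G.outcome σ v 0 = v := rfl

theorem outcome_succ (σ : P → Move V) (v : V) (n : ℕ) :
    G.outcome σ v (n + 1) = σ (G.owner (G.outcome σ v n)) (initialSegment (G.outcome σ v) n)
      (G.outcome σ v n) := by
  rw [← outcomeHist_fst]; rfl

@[simp] theorem subgame_outcome (h : List V) (σ : P → Move V) (v : V) :
    (G.subgame h).outcome σ v = G.outcome σ v := by
  have : ∀ n, (G.subgame h).outcomeHist σ v n = G.outcomeHist σ v n := by
    intro n
    induction n with
    | zero => rfl
    | succ n ih => simp only [outcomeHist, ih]; rfl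
  funext n
  simp only [outcome, this]

theorem isHist_singleton {v w : V} : G.IsHist v ([] ++ [w]) ↔ w = v := by
  simp [IsHist]

theorem isHist_snoc {v₀ v w : V} {h : List V} :
    G.IsHist v₀ (h ++ [v] ++ [w]) ↔ G.IsHist v₀ (h ++ [v]) ∧ G.edge v w := by
  simp only [IsHist]
  rw [show h ++ [v] ++ [w] = h ++ v :: [w] by simp, List.isChain_split]
  cases h <;> simp [and_assoc]

/-- The word `h' ++ [w]` begins with `v`, so the two histories overlap in that vertex. -/
theorem IsHist.append {v₀ v w : V} {h h' : List V} (hh : G.IsHist v₀ (h ++ [v]))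
    (hh' : G.IsHist v (h' ++ [w])) : G.IsHist v₀ (h ++ h' ++ [w]) := by
  obtain ⟨t, ht⟩ : ∃ t, h' ++ [w] = v :: t := by
    have := hh'.1
    cases e : h' ++ [w] with
    | nil => simp at e
    | cons a t => rw [e] at this; simp at this; exact ⟨t, by rw [this]⟩
  rw [List.append_assoc, ht]
  refine ⟨?_, List.isChain_split.2 ⟨hh.2, ht ▸ hh'.2⟩⟩
  have := hh.1
  cases h <;> simpa using this

theorem IsPlay.prepend {h : List V} {v : V} {ρ : ℕ → V} (hh : (h ++ [v]).IsChain G.edge)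
    (h0 : ρ 0 = v) (hρ : G.IsPlay ρ) : G.IsPlay (prepend h ρ) := by
  induction h with
  | nil => simpa using hρ
  | cons a h ih =>
    have ih := ih (by simp only [List.cons_append] at hh; exact hh.of_cons)
    intro n
    cases n with
    | succ n => simpa using ih n
    | zero =>
      cases h with
      | nil => simp at hh; simpa [h0] using hh
      | cons b h => simp at hh; simpa using hh.1

theorem IsPlay.drop {ρ : ℕ → V} (hρ : G.IsPlay ρ) (n : ℕ) : G.IsPlay (fun m => ρ (n + m)) :=
  fun m => hρ (n + m)

theorem PrefixIndependent.drop {i : P} (hi : G.PrefixIndependent i) {ρ : ℕ → V}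
    (hρ : G.IsPlay ρ) (n : ℕ) : G.cost i (fun m => ρ (n + m)) = G.cost i ρ := by
  have := hi (initialSegment ρ n) (fun m => ρ (n + m)) (by rwa [prepend_initialSegment])
  rw [← this, prepend_initialSegment]

/-- Prefix-independence speaks of plays only, so `h` must connect to the first vertex of `ρ`. -/
theorem PrefixIndependent.subgame_cost {i : P} (hi : G.PrefixIndependent i) {h : List V}
    {v₀ v : V} {ρ : ℕ → V} (hh : G.IsHist v₀ (h ++ [v])) (h0 : ρ 0 = v) (hρ : G.IsPlay ρ) :
    (G.subgame h).cost i ρ = G.cost i ρ :=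
  hi h ρ (hρ.prepend hh.2 h0)

theorem IsProfile.isHist_outcome {v : V} {σ : P → Move V} (hσ : G.IsProfile v σ) (n : ℕ) :
    G.IsHist v (initialSegment (G.outcome σ v) n ++ [G.outcome σ v n]) := by
  induction n with
  | zero => exact isHist_singleton.2 rfl
  | succ n ih =>
    rw [initialSegment_succ, isHist_snoc]
    refine ⟨ih, ?_⟩
    rw [outcome_succ]
    exact hσ _ _ _ ih rfl

theorem IsProfile.isPlay_outcome {v : V} {σ : P → Move V} (hσ : G.IsProfile v σ) :
    G.IsPlay (G.outcome σ v) := by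
  intro n
  have := hσ.isHist_outcome (n + 1)
  rw [initialSegment_succ, isHist_snoc] at this
  exact this.2

theorem IsProfile.deviate {v : V} {σ : P → Move V} (hσ : G.IsProfile v σ) {i : P} {σ' : Move V}
    (hσ' : G.IsStrategy v i σ') : G.IsProfile v (deviate σ i σ') := by
  intro j
  by_cases hj : j = i
  · subst hj; simpa [QuantGame.deviate] using hσ'
  · simpa [QuantGame.deviate, hj] using hσ j

theorem IsProfile.shift {v₀ v : V} {σ : P → Move V} (hσ : G.IsProfile v₀ σ) {h : List V}
    (hh : G.IsHist v₀ (h ++ [v])) : G.IsProfile v (shift σ h) :=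
  fun i _ w hw hi => hσ i _ w (hh.append hw) hi

/-- After a prefix of the outcome, the outcome continues in the same way. -/
theorem outcome_shift_initialSegment (σ : P → Move V) (v : V) (h : List V) (n m : ℕ) :
    G.outcome (shift σ (h ++ initialSegment (G.outcome (shift σ h) v) n))
      (G.outcome (shift σ h) v n) m = G.outcome (shift σ h) v (n + m) := by
  induction m using Nat.strong_induction_on with
  | _ m ih =>
    cases m with
    | zero => rfl
    | succ m =>
      have hseg : initialSegment (G.outcome (shift σ h) v) n ++
          initialSegment (G.outcome (shift σ (h ++ initialSegment (G.outcome (shift σ h) v) n))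
            (G.outcome (shift σ h) v n)) m = initialSegment (G.outcome (shift σ h) v) (n + m) := by
        simp only [initialSegment, List.range_add, List.map_append, List.map_map]
        congr 1
        refine List.map_congr_left fun k hk => ?_
        rw [List.mem_range] at hk
        exact ih k (by omega)
      rw [outcome_succ, ih m (by omega), ← add_assoc, outcome_succ, ← hseg]
      simp [shift]

end QuantGame

/-! ## Equilibrium machines -/

/-- A machine whose states are labelled by vertices and cost vectors, all of whose runs yield
plays with the labelled cost, and on which deviating never pays. -/
structure EqMachine {P V : Type*} (G : QuantGame P V) (v₀ : V) (X : Type*) where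
  init : X
  vert : X → V
  out : X → V
  upd : X → V → X
  cost : X → P → WithTop ℝ
  start : X → Prop
  vert_init : vert init = v₀
  start_init : start init
  edge_out : ∀ x, G.edge (vert x) (out x)
  vert_upd : ∀ x v, G.edge (vert x) v → vert (upd x v) = v
  cost_next : ∀ x, cost (upd x (out x)) = cost x
  cost_deviation : ∀ x v, G.edge (vert x) v →
    cost x (G.owner (vert x)) ≤ cost (upd x v) (G.owner (vert x))
  start_upd : ∀ x v, G.edge (vert x) v → v ≠ out x → start (upd x v)
  cost_orbit : ∀ x, start x → ∀ i,
    G.cost i (fun n => vert ((fun y => upd y (out y))^[n] x)) = cost x i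

namespace EqMachine

variable {P V X : Type*} {G : QuantGame P V} {v₀ : V} (M : EqMachine G v₀ X)

def next (x : X) : X := M.upd x (M.out x)

/-- The state after a nonempty history. -/
def state (h : List V) : X := h.tail.foldl M.upd M.init

/-- All players use the same map: the machine proposes a successor whoever owns the current vertex.
-/
def strategy : P → Move V := fun _ h v => M.out (M.state (h ++ [v]))

def orbit (x : X) : ℕ → V := fun n => M.vert (M.next^[n] x)

theorem state_snoc (h : List V) (v w : V) :
    M.state (h ++ [v] ++ [w]) = M.upd (M.state (h ++ [v])) w := by
  cases h <;> simp [state]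

theorem vert_next (x : X) : M.vert (M.next x) = M.out x := M.vert_upd _ _ (M.edge_out x)

theorem isPlay_orbit (x : X) : G.IsPlay (M.orbit x) := by
  intro n
  simp only [orbit, Function.iterate_succ_apply', vert_next]
  exact M.edge_out _

theorem cost_iterate (x : X) (n : ℕ) : M.cost (M.next^[n] x) = M.cost x := by
  induction n with
  | zero => rfl
  | succ n ih => rw [Function.iterate_succ_apply', ← ih]; exact M.cost_next _

/-- Every departure from the output leads to a start state, so a reachable state lies on the orbit
of the state entered at the last departure, or of `init`. Costs of orbits are only known from start
states, and this transports them to all reachable states. -/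
theorem state_spec {h : List V} {v : V} (hh : G.IsHist v₀ (h ++ [v])) :
    M.vert (M.state (h ++ [v])) = v ∧ ∃ y n, M.start y ∧ M.state (h ++ [v]) = M.next^[n] y := by
  induction h using List.reverseRecOn generalizing v with
  | nil =>
    rw [QuantGame.isHist_singleton] at hh
    exact ⟨by rw [hh]; exact M.vert_init, M.init, 0, M.start_init, rfl⟩
  | append_singleton h u ih =>
    rw [QuantGame.isHist_snoc] at hh
    obtain ⟨h1, y, n, hy, hn⟩ := ih hh.1
    have he : G.edge (M.vert (M.state (h ++ [u]))) v := by rw [h1]; exact hh.2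
    rw [state_snoc]
    refine ⟨M.vert_upd _ _ he, ?_⟩
    by_cases hv : v = M.out (M.state (h ++ [u]))
    · refine ⟨y, n + 1, hy, ?_⟩
      rw [Function.iterate_succ_apply', ← hn, hv]; rfl
    · exact ⟨_, 0, M.start_upd _ _ he hv, rfl⟩

theorem cost_orbit_state (hG : ∀ i, G.PrefixIndependent i) {h : List V} {v : V}
    (hh : G.IsHist v₀ (h ++ [v])) (i : P) :
    G.cost i (M.orbit (M.state (h ++ [v]))) = M.cost (M.state (h ++ [v])) i := by
  obtain ⟨-, y, n, hy, hn⟩ := M.state_spec hh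
  rw [hn, cost_iterate, ← M.cost_orbit y hy i]
  have := (hG i).drop (M.isPlay_orbit y) n
  rw [show M.orbit (M.next^[n] y) = fun m => M.orbit y (n + m) from ?_]
  · exact this
  · funext m
    simp only [orbit, ← Function.iterate_add_apply, Nat.add_comm]

theorem isProfile_strategy : G.IsProfile v₀ M.strategy := by
  intro i h v hh _
  have := M.edge_out (M.state (h ++ [v]))
  rwa [(M.state_spec hh).1] at this

/-- A play that follows the strategy from some point on is, from this point on, an orbit. -/
theorem state_of_follows {h : List V} {ρ : ℕ → V} {m : ℕ}
    (hm : ∀ n, m ≤ n → ρ (n + 1) = M.out (M.state (h ++ initialSegment ρ n ++ [ρ n]))) (n : ℕ) :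
    M.state (h ++ initialSegment ρ (m + n) ++ [ρ (m + n)]) =
      M.next^[n] (M.state (h ++ initialSegment ρ m ++ [ρ m])) := by
  induction n with
  | zero => rfl
  | succ n ih =>
    rw [Function.iterate_succ_apply', ← ih, ← add_assoc, initialSegment_succ, ← List.append_assoc,
      state_snoc, hm _ (by omega)]
    rfl

/-- Prefix-independence discards the first `m` letters, and the rest of `ρ` is an orbit. -/
theorem cost_of_follows (hG : ∀ i, G.PrefixIndependent i) {h : List V} {ρ : ℕ → V} {m : ℕ}
    (hρ : G.IsPlay ρ) (hist : ∀ n, G.IsHist v₀ (h ++ initialSegment ρ n ++ [ρ n]))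
    (hm : ∀ n, m ≤ n → ρ (n + 1) = M.out (M.state (h ++ initialSegment ρ n ++ [ρ n]))) (i : P) :
    G.cost i ρ = M.cost (M.state (h ++ initialSegment ρ m ++ [ρ m])) i := by
  rw [← (hG i).drop hρ m, ← M.cost_orbit_state hG (hist m)]
  congr 1
  funext n
  rw [← (M.state_spec (hist (m + n))).1, M.state_of_follows hm]
  rfl

theorem cost_outcome_shift (hG : ∀ i, G.PrefixIndependent i) {h : List V} {v : V}
    (hh : G.IsHist v₀ (h ++ [v])) (i : P) :
    G.cost i (G.outcome (QuantGame.shift M.strategy h) v) = M.cost (M.state (h ++ [v])) i := by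
  have hp := M.isProfile_strategy.shift hh
  rw [M.cost_of_follows (h := h) (m := 0) hG hp.isPlay_outcome
    (fun n => hh.append (hp.isHist_outcome n))]
  · simp
  · intro n _
    rw [QuantGame.outcome_succ]; rfl

theorem cost_outcome (hG : ∀ i, G.PrefixIndependent i) (i : P) :
    G.cost i (G.outcome M.strategy v₀) = M.cost M.init i :=
  M.cost_outcome_shift hG (h := []) (QuantGame.isHist_singleton.2 rfl) i

-- The label of the deviator is a potential: it is constant along outputs and cannot drop at a
-- deviation. After finitely many deviations the play is an orbit, whose cost is the label reached.
open QuantGame in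
open Classical in
theorem isWeakSPE (hG : ∀ i, G.PrefixIndependent i) : G.IsWeakSPE v₀ M.strategy := by
  refine ⟨M.isProfile_strategy, fun h v hh => ⟨M.isProfile_strategy.shift hh, ?_⟩⟩
  intro i σ' hσ' hfin
  have hp : G.IsProfile v (shift M.strategy h) := M.isProfile_strategy.shift hh
  have hq : G.IsProfile v (deviate (shift M.strategy h) i σ') := hp.deviate hσ'
  rw [subgame_outcome, subgame_outcome,
    (hG i).subgame_cost hh (by rfl) hp.isPlay_outcome,
    (hG i).subgame_cost hh (by rfl) hq.isPlay_outcome,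
    M.cost_outcome_shift hG hh]
  set ρ := G.outcome (deviate (shift M.strategy h) i σ') v with hρ
  have hist : ∀ n, G.IsHist v₀ (h ++ initialSegment ρ n ++ [ρ n]) :=
    fun n => hh.append (hq.isHist_outcome n)
  have hplay : G.IsPlay ρ := hq.isPlay_outcome
  -- a step either follows the machine or is a deviation step
  have hstep : ∀ n, ρ (n + 1) = M.out (M.state (h ++ initialSegment ρ n ++ [ρ n])) ∨
      (G.owner (ρ n) = i ∧
        (G.subgame h).DeviationStep v (shift M.strategy h) i σ' (initialSegment ρ n) (ρ n)) := by
    intro n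
    have hs : ρ (n + 1) = deviate (shift M.strategy h) i σ' (G.owner (ρ n))
        (initialSegment ρ n) (ρ n) := outcome_succ _ _ _
    by_cases ho : G.owner (ρ n) = i
    · by_cases hd : shift M.strategy h i (initialSegment ρ n) (ρ n) = σ' (initialSegment ρ n) (ρ n)
      · left
        rw [hs, ho]
        simp only [deviate, Function.update_self, ← hd]
        rfl
      · refine Or.inr ⟨ho, ho, ?_, hd⟩
        rw [subgame_outcome, ← hρ, length_initialSegment, ← initialSegment_succ]
        rfl
    · left
      rw [hs]
      simp only [deviate, Function.update_of_ne ho]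
      rfl
  have hmono : ∀ n, M.cost (M.state (h ++ [v])) i ≤
      M.cost (M.state (h ++ initialSegment ρ n ++ [ρ n])) i := by
    intro n
    induction n with
    | zero => simp [hρ]
    | succ n ih =>
      refine ih.trans ?_
      rw [initialSegment_succ, ← List.append_assoc, state_snoc]
      have hv := (M.state_spec (hist n)).1
      rcases hstep n with hn | ⟨hn, -⟩
      · rw [hn, M.cost_next]
      · have := M.cost_deviation (M.state (h ++ initialSegment ρ n ++ [ρ n])) (ρ (n + 1))
          (by rw [hv]; exact hplay n)
        rwa [hv, hn] at this
  obtain ⟨m, hm⟩ : ∃ m, ∀ n, m ≤ n →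
      ρ (n + 1) = M.out (M.state (h ++ initialSegment ρ n ++ [ρ n])) := by
    have hfin' := (hfin.image (fun p : List V × V => p.1.length)).bddAbove
    obtain ⟨m, hm⟩ := hfin'
    -- The deviation step at time `n` has a history of length `n`, and `m` bounds these lengths.
    refine ⟨m + 1, fun n hn => (hstep n).resolve_right fun hd => ?_⟩
    have := hm ⟨(initialSegment ρ n, ρ n), hd.2, rfl⟩
    simp at this
    omega
  rw [M.cost_of_follows hG hplay hist hm]
  exact hmono m

end EqMachine

/-! ## The cost vectors realized by a weak subgame perfect equilibrium -/

namespace QuantGame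

variable {P V : Type*} {G : QuantGame P V} {v₀ : V} {σ : P → Move V}

/-- The vector `p` is the cost of the outcome of `σ` after some history that ends in `v`. -/
def Realized (G : QuantGame P V) (v₀ : V) (σ : P → Move V) (v : V) (p : P → WithTop ℝ) : Prop :=
  ∃ h, G.IsHist v₀ (h ++ [v]) ∧ ∀ i, G.cost i (G.outcome (shift σ h) v) = p i

theorem realized_init (v₀ : V) (σ : P → Move V) :
    G.Realized v₀ σ v₀ (fun i => G.cost i (G.outcome σ v₀)) :=
  ⟨[], isHist_singleton.2 rfl, fun _ => rfl⟩

/-- The tail of an outcome is the outcome after a longer history, and prefix-independence gives it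
the same cost. -/
theorem IsWeakSPE.exists_play (hG : ∀ i, G.PrefixIndependent i) (hσ : G.IsWeakSPE v₀ σ) {v : V}
    {p : P → WithTop ℝ} (hp : G.Realized v₀ σ v p) :
    ∃ ρ, G.IsPlay ρ ∧ ρ 0 = v ∧ (∀ i, G.cost i ρ = p i) ∧ ∀ n, G.Realized v₀ σ (ρ n) p := by
  obtain ⟨h, hh, hc⟩ := hp
  have hs := hσ.1.shift hh
  refine ⟨G.outcome (shift σ h) v, hs.isPlay_outcome, rfl, hc, fun n => ?_⟩
  refine ⟨_, hh.append (hs.isHist_outcome n), fun i => ?_⟩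
  rw [← hc i, ← (hG i).drop hs.isPlay_outcome n]
  congr 1
  funext m
  exact outcome_shift_initialSegment σ v h n m

-- The owner of `v` moves to `w` once and then obeys `σ`. The play so obtained is `v` followed by
-- the outcome after `h ++ [v]` from `w`, so the weak Nash condition compares exactly the two costs
-- wanted.
open Classical in
theorem IsWeakSPE.exists_deviation (hG : ∀ i, G.PrefixIndependent i) (hσ : G.IsWeakSPE v₀ σ)
    {v w : V} {p : P → WithTop ℝ} (hp : G.Realized v₀ σ v p) (hvw : G.edge v w) :
    ∃ p', G.Realized v₀ σ w p' ∧ p (G.owner v) ≤ p' (G.owner v) := by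
  obtain ⟨h, hh, hc⟩ := hp
  have hh' : G.IsHist v₀ (h ++ [v] ++ [w]) := isHist_snoc.2 ⟨hh, hvw⟩
  refine ⟨_, ⟨h ++ [v], hh', fun _ => rfl⟩, ?_⟩
  have hs := hσ.1.shift hh
  set i := G.owner v with hi
  -- In the subgame, the empty history is the only one at which `σ'` can differ from `σ`.
  set σ' : Move V := fun h' u => if h' = [] then w else shift σ h i h' u with hσ'
  have hstrat : G.IsStrategy v i σ' := by
    intro h' u hu ho
    by_cases h0 : h' = []
    · subst h0
      rw [isHist_singleton] at hu
      simpa [hσ', hu] using hvw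
    · simp only [hσ', if_neg h0]
      exact hs i h' u hu ho
  have hdev : ∀ j h' u, h' ≠ [] → deviate (shift σ h) i σ' j h' u = shift σ h j h' u := by
    intro j h' u h0
    by_cases hj : j = i
    · subst hj; simp [deviate, hσ', h0]
    · simp [deviate, Function.update_of_ne hj]
  -- Strong induction is needed because moves depend on the whole history.
  have hout : ∀ n, G.outcome (deviate (shift σ h) i σ') v (n + 1) =
      G.outcome (shift σ (h ++ [v])) w n := by
    intro n
    induction n using Nat.strong_induction_on with
    | _ n ih =>
      cases n with
      | zero => rw [outcome_succ, outcome_zero, ← hi]; simp [deviate, hσ']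
      | succ n =>
        rw [outcome_succ, hdev _ _ _ (by rw [initialSegment_succ]; simp), ih n (by omega),
          outcome_succ, initialSegment_succ']
        have : initialSegment (fun m => G.outcome (deviate (shift σ h) i σ') v (m + 1)) n =
            initialSegment (G.outcome (shift σ (h ++ [v])) w) n :=
          List.map_congr_left fun k hk => ih k (by rw [List.mem_range] at hk; omega)
        rw [this]
        simp [shift]
  have hq : G.IsProfile v (deviate (shift σ h) i σ') := hs.deviate hstrat
  have hfin : (G.subgame h).FinitelyDeviating v (shift σ h) i σ' := by
    refine (Set.finite_singleton (([] : List V), v)).subset ?_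
    rintro ⟨h', u⟩ ⟨-, h2, h3⟩
    have h0 : h' = [] := by
      by_contra h0
      exact h3 (by simp only [hσ', if_neg h0])
    subst h0
    simp at h2
    simp [h2]
  have := (hσ.2 h v hh).2 i σ' hstrat hfin
  rw [subgame_outcome, subgame_outcome, (hG i).subgame_cost hh (by rfl) hs.isPlay_outcome,
    (hG i).subgame_cost hh (by rfl) hq.isPlay_outcome, hc i, ← (hG i).drop hq.isPlay_outcome 1] at this
  refine this.trans_eq ?_
  congr 1
  funext m
  rw [add_comm, hout]

end QuantGame

/-! ## Positional runs for conjunctions of Büchi conditions -/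

section Buchi

variable {Y : Type*} {k : ℕ}

/-- An infinite `R`-path that satisfies all Büchi conditions `Acc i`. -/
structure IsFairPath (R : Y → Y → Prop) (Acc : Fin k → Y → Prop) (r : ℕ → Y) : Prop where
  step : ∀ n, R (r n) (r (n + 1))
  fair : ∀ i, ∃ᶠ n in atTop, Acc i (r n)

theorem IsFairPath.tail {R : Y → Y → Prop} {Acc : Fin k → Y → Prop} {r : ℕ → Y}
    (h : IsFairPath R Acc r) : IsFairPath R Acc (fun n => r (n + 1)) where
  step n := h.step (n + 1)
  fair i := by
    rw [frequently_atTop]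
    intro a
    obtain ⟨b, hb, hb'⟩ := frequently_atTop.1 (h.fair i) (a + 1)
    exact ⟨b - 1, by omega, by rwa [Nat.sub_add_cancel (by omega)]⟩

/-- The sources of fair paths. -/
def fairSet (R : Y → Y → Prop) (Acc : Fin k → Y → Prop) : Set Y :=
  {y | ∃ r, IsFairPath R Acc r ∧ r 0 = y}

/-- With a counter that remembers the next condition to be met, fair paths are positional. -/
theorem exists_positional [NeZero k] (R : Y → Y → Prop) (Acc : Fin k → Y → Prop) :
    ∃ next : Y × Fin k → Y × Fin k, ∀ z, z.1 ∈ fairSet R Acc →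
      R z.1 (next z).1 ∧ (next z).1 ∈ fairSet R Acc ∧ ∀ i, ∃ n, Acc i (next^[n] z).1 := by
  classical
  have hd : ∀ y ∈ fairSet R Acc, ∀ i, ∃ n, ∃ r, IsFairPath R Acc r ∧ r 0 = y ∧ Acc i (r n) := by
    rintro y ⟨r, hr, h0⟩ i
    obtain ⟨n, hn⟩ := (hr.fair i).exists
    exact ⟨n, r, hr, h0, hn⟩
  -- The shortest delay after which a fair path from `y` can meet condition `i`. It is attained on
  -- `fairSet` and decreases along a path that attains it.
  let dist : Fin k → Y → ℕ := fun i y =>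
    sInf {n | ∃ r, IsFairPath R Acc r ∧ r 0 = y ∧ Acc i (r n)}
  have hstep : ∀ z : Y × Fin k, ∃ y', z.1 ∈ fairSet R Acc → R z.1 y' ∧ y' ∈ fairSet R Acc ∧
      (¬ Acc z.2 z.1 → dist z.2 y' < dist z.2 z.1) := by
    rintro ⟨y, i⟩
    by_cases hy : y ∈ fairSet R Acc
    · obtain ⟨r, hr, h0, hn⟩ : dist i y ∈ {n | ∃ r, IsFairPath R Acc r ∧ r 0 = y ∧ Acc i (r n)} :=
        Nat.sInf_mem (hd y hy i)
      refine ⟨r 1, fun _ => ⟨h0 ▸ hr.step 0, ⟨_, hr.tail, rfl⟩, fun hacc => ?_⟩⟩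
      have hpos : dist i y ≠ 0 := fun h => hacc (by rw [h, h0] at hn; exact hn)
      have : dist i (r 1) ≤ dist i y - 1 := by
        refine Nat.sInf_le ⟨_, hr.tail, rfl, ?_⟩
        rwa [Nat.sub_add_cancel (by omega)]
      show dist i (r 1) < dist i y
      omega
    · exact ⟨y, fun h => absurd h hy⟩
  choose succ hsucc using hstep
  -- The counter advances cyclically, and only when its condition is met.
  let next : Y × Fin k → Y × Fin k := fun z => (succ z, if Acc z.2 z.1 then z.2 + 1 else z.2)
  have hfair : ∀ z : Y × Fin k, z.1 ∈ fairSet R Acc → ∀ n, (next^[n] z).1 ∈ fairSet R Acc := by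
    intro z hz n
    induction n with
    | zero => exact hz
    | succ n ih => rw [Function.iterate_succ_apply']; exact (hsucc _ ih).2.1
  -- the current condition is met eventually
  have hcur : ∀ d, ∀ z : Y × Fin k, z.1 ∈ fairSet R Acc → dist z.2 z.1 = d →
      ∃ n, (next^[n] z).2 = z.2 ∧ Acc z.2 (next^[n] z).1 := by
    intro d
    induction d using Nat.strong_induction_on with
    | _ d ih =>
      intro z hz hdz
      by_cases hacc : Acc z.2 z.1
      · exact ⟨0, rfl, hacc⟩
      · obtain ⟨-, h2, h3⟩ := hsucc z hz
        have e : (next z).2 = z.2 := by simp [next, hacc]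
        obtain ⟨n, hn, hn'⟩ := ih (dist (next z).2 (next z).1)
          (by rw [e]; exact hdz ▸ h3 hacc) (next z) h2 rfl
        refine ⟨n + 1, ?_⟩
        rw [Function.iterate_succ_apply, ← e]
        exact ⟨hn, hn'⟩
  -- Once a condition is met, the counter passes to the next one, so all conditions have their turn.
  -- Since `fairSet` is invariant, each of them is then met infinitely often.
  have hall : ∀ (j : ℕ) (z : Y × Fin k), z.1 ∈ fairSet R Acc →
      ∃ n, (next^[n] z).2 = z.2 + Fin.ofNat k j ∧ Acc (z.2 + Fin.ofNat k j) (next^[n] z).1 := by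
    intro j z hz
    induction j with
    | zero => simpa using hcur _ z hz rfl
    | succ j ih =>
      obtain ⟨n, hn, hn'⟩ := ih
      have e : (next^[n + 1] z).2 = z.2 + Fin.ofNat k (j + 1) := by
        rw [Function.iterate_succ_apply']
        have : Fin.ofNat k (j + 1) = Fin.ofNat k j + 1 := by
          ext; simp [Fin.ofNat, Fin.val_add]
        rw [this, ← add_assoc, ← hn]
        simp only [next]
        rw [if_pos (by rw [hn]; exact hn')]
      obtain ⟨m, hm, hm'⟩ := hcur _ (next^[n + 1] z) (hfair z hz _) rfl
      refine ⟨m + (n + 1), ?_⟩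
      rw [Function.iterate_add_apply, ← e]
      exact ⟨hm, hm'⟩
  refine ⟨next, fun z hz => ⟨(hsucc z hz).1, (hsucc z hz).2.1, fun i => ?_⟩⟩
  obtain ⟨n, -, hn⟩ := hall ((i - z.2 : Fin k) : ℕ) z hz
  refine ⟨n, ?_⟩
  have : z.2 + Fin.ofNat k ((i - z.2 : Fin k) : ℕ) = i := by
    rw [Fin.ofNat_val_eq_self]; simp
  rwa [this] at hn

end Buchi

/-! ## Primitive recursive predicates -/

section Primrec

variable {α : Type*} [Primcodable α]

theorem Primrec.nat_pow : Primrec₂ ((· ^ ·) : ℕ → ℕ → ℕ) :=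
  Primrec₂.unpaired'.1 Nat.Primrec.pow

/-- A bound that depends on the input is handled by quantifying over the list `List.range (f a)`. -/
theorem PrimrecPred.forall_lt_apply {f : α → ℕ} {p : α → ℕ → Prop} (hf : Primrec f)
    (hp : PrimrecPred fun q : α × ℕ => p q.1 q.2) : PrimrecPred fun a => ∀ x < f a, p a x :=
  (PrimrecRel.comp (PrimrecRel.forall_mem_list (R := fun (x : ℕ) (a : α) => p a x)
    (hp.comp (Primrec.pair Primrec.snd Primrec.fst))) (Primrec.list_range.comp hf)
      Primrec.id).of_eq fun a => by simp

theorem PrimrecPred.exists_lt_apply {f : α → ℕ} {p : α → ℕ → Prop} (hf : Primrec f)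
    (hp : PrimrecPred fun q : α × ℕ => p q.1 q.2) : PrimrecPred fun a => ∃ x < f a, p a x :=
  (PrimrecRel.comp (PrimrecRel.exists_mem_list (R := fun (x : ℕ) (a : α) => p a x)
    (hp.comp (Primrec.pair Primrec.snd Primrec.fst))) (Primrec.list_range.comp hf)
      Primrec.id).of_eq fun a => by simp

theorem PrimrecPred.imp {p q : α → Prop} (hp : PrimrecPred p) (hq : PrimrecPred q) :
    PrimrecPred fun a => p a → q a :=
  (hp.not.or hq).of_eq fun _ => imp_iff_not_or.symm

theorem PrimrecPred.mem_list {β : Type*} [Primcodable β] {f : α → β} {l : α → List β}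
    (hf : Primrec f) (hl : Primrec l) : PrimrecPred fun a => f a ∈ l a := by
  refine (PrimrecRel.comp (R := fun (l : List β) b => ∃ a ∈ l, a = b)
    (PrimrecRel.exists_mem_list (Primrec.eq (α := β))) hl hf).of_eq fun a => ?_
  simp

theorem Primrec.add {f g : α → ℕ} (hf : Primrec f) (hg : Primrec g) :
    Primrec fun a => f a + g a := Primrec.nat_add.comp hf hg

theorem Primrec.mul {f g : α → ℕ} (hf : Primrec f) (hg : Primrec g) :
    Primrec fun a => f a * g a := Primrec.nat_mul.comp hf hg

theorem Primrec.pow {f g : α → ℕ} (hf : Primrec f) (hg : Primrec g) :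
    Primrec fun a => f a ^ g a := Primrec.nat_pow.comp hf hg

theorem PrimrecPred.lt {f g : α → ℕ} (hf : Primrec f) (hg : Primrec g) :
    PrimrecPred fun a => f a < g a := Primrec.nat_lt.comp hf hg

theorem PrimrecPred.le {f g : α → ℕ} (hf : Primrec f) (hg : Primrec g) :
    PrimrecPred fun a => f a ≤ g a := Primrec.nat_le.comp hf hg

theorem PrimrecPred.eq {f g : α → ℕ} (hf : Primrec f) (hg : Primrec g) :
    PrimrecPred fun a => f a = g a := Primrec.eq.comp hf hg

end Primrec

/-- The digit with index `t` of `n` in base `b`. -/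
def digit (b n t : ℕ) : ℕ := n / b ^ t % b

/-- `finFunctionFinEquiv` is positional notation, and its inverse reads off the digits. -/
theorem exists_digit_eq {b l : ℕ} {f : ℕ → ℕ} (hf : ∀ t < l, f t < b) :
    ∃ n < b ^ l, ∀ t < l, digit b n t = f t := by
  let F : Fin l → Fin b := fun t => ⟨f t, hf t t.2⟩
  refine ⟨(finFunctionFinEquiv F : ℕ), (finFunctionFinEquiv F).2, fun t ht => ?_⟩
  have := congrFun (finFunctionFinEquiv.symm_apply_apply F) ⟨t, ht⟩
  exact congrArg Fin.val this

/-! ### Codes, certificates and their primitive recursive verification -/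

section Codes

theorem primrec_ratCode_pos : Primrec RatCode.pos :=
  Primrec.fst.comp (Primrec.of_equiv (e := RatCode.equiv))

theorem primrec_ratCode_neg : Primrec RatCode.neg :=
  (Primrec.fst.comp Primrec.snd).comp (Primrec.of_equiv (e := RatCode.equiv))

theorem primrec_ratCode_den : Primrec RatCode.den :=
  (Primrec.snd.comp Primrec.snd).comp (Primrec.of_equiv (e := RatCode.equiv))

theorem primrec_buchiCode_states : Primrec BuchiCode.states :=
  Primrec.fst.comp (Primrec.of_equiv (e := BuchiCode.equiv))

theorem primrec_buchiCode_start : Primrec BuchiCode.start :=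
  (Primrec.fst.comp Primrec.snd).comp (Primrec.of_equiv (e := BuchiCode.equiv))

theorem primrec_buchiCode_accept : Primrec BuchiCode.accept :=
  (Primrec.fst.comp (Primrec.snd.comp Primrec.snd)).comp
    (Primrec.of_equiv (e := BuchiCode.equiv))

theorem primrec_buchiCode_trans : Primrec BuchiCode.trans :=
  (Primrec.snd.comp (Primrec.snd.comp Primrec.snd)).comp
    (Primrec.of_equiv (e := BuchiCode.equiv))

theorem primrec_mooreCode_mk {α : Type*} [Primcodable α] {f g : α → ℕ} {h : α → List (List ℕ)}
    {k : α → List ℕ} (hf : Primrec f) (hg : Primrec g) (hh : Primrec h) (hk : Primrec k) :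
    Primrec fun a => MooreCode.mk (f a) (g a) (h a) (k a) :=
  (Primrec.of_equiv_symm (e := MooreCode.equiv)).comp (hf.pair (hg.pair (hh.pair hk)))

theorem primrec_gameCode_players : Primrec GameCode.players :=
  Primrec.fst.comp (Primrec.of_equiv (e := GameCode.equiv))

theorem primrec_gameCode_vertices : Primrec GameCode.vertices :=
  (Primrec.fst.comp Primrec.snd).comp (Primrec.of_equiv (e := GameCode.equiv))

theorem primrec_gameCode_owner : Primrec GameCode.owner :=
  (Primrec.fst.comp (Primrec.snd.comp Primrec.snd)).comp (Primrec.of_equiv (e := GameCode.equiv))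

theorem primrec_gameCode_edges : Primrec GameCode.edges :=
  (Primrec.fst.comp (Primrec.snd.comp (Primrec.snd.comp Primrec.snd))).comp
    (Primrec.of_equiv (e := GameCode.equiv))

theorem primrec_gameCode_init : Primrec GameCode.init :=
  (Primrec.fst.comp (Primrec.snd.comp (Primrec.snd.comp (Primrec.snd.comp Primrec.snd)))).comp
    (Primrec.of_equiv (e := GameCode.equiv))

theorem primrec_gameCode_levels : Primrec GameCode.levels :=
  (Primrec.snd.comp (Primrec.snd.comp (Primrec.snd.comp (Primrec.snd.comp Primrec.snd)))).comp
    (Primrec.of_equiv (e := GameCode.equiv))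

/-- Comparison of the values of two codes. -/
def RatCode.Le (a b : RatCode) : Prop :=
  a.pos * (b.den + 1) + b.neg * (a.den + 1) ≤ b.pos * (a.den + 1) + a.neg * (b.den + 1)

/-- Cross-multiply by the positive denominators and move the negative parts across, so that only
natural numbers are compared. -/
theorem RatCode.le_iff (a b : RatCode) : a.Le b ↔ a.value ≤ b.value := by
  have ha : (0 : ℚ) < (a.den : ℚ) + 1 := by positivity
  have hb : (0 : ℚ) < (b.den : ℚ) + 1 := by positivity
  rw [RatCode.Le, RatCode.value, RatCode.value, div_le_div_iff₀ ha hb, ← Nat.cast_le (α := ℚ)]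
  push_cast
  constructor <;> intro h <;> linarith

instance : Inhabited RatCode := ⟨⟨0, 0, 0⟩⟩
instance : Inhabited BuchiCode := ⟨⟨0, [], [], []⟩⟩

namespace GameCode

/-- The entry with index `e` in the list of costs of player `i`. -/
def entry (c : GameCode) (i e : ℕ) : RatCode × List BuchiCode :=
  (c.levels.getD i []).getD e (default, [])

/-- The automaton for the plays from `o` with the cost of index `e` for player `i`. -/
def automaton (c : GameCode) (i e o : ℕ) : BuchiCode := (c.entry i e).2.getD o default

/-- The total number of listed costs of all players, which bounds each index into one list. -/
def levelBound (c : GameCode) : ℕ := c.levels.flatten.length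

/-- The sum over all listed automata, which bounds the number of states of each of them. -/
def stateBound (c : GameCode) : ℕ :=
  ((c.levels.flatten.flatMap Prod.snd).map BuchiCode.states).sum

/-- The number of states of the machines to be searched. -/
def nodeBound (c : GameCode) : ℕ :=
  c.vertices * c.vertices * c.players * c.levelBound ^ c.players * c.stateBound ^ c.players

/-- The base of the representation of tables by numbers. -/
def base (c : GameCode) : ℕ :=
  c.nodeBound + c.players + c.vertices + c.levelBound + c.stateBound + 1

/-- A number `n` stands for seven tables of size `base × base`. -/
def table (c : GameCode) (n j x i : ℕ) : ℕ := digit c.base n (j + 7 * (i + c.base * x))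

def tablesBound (c : GameCode) : ℕ := c.base ^ (7 * (c.base * c.base))

section

variable {α : Type*} [Primcodable α] {c : α → GameCode} {n j x i e o : α → ℕ}

theorem primrec_entry (hc : Primrec c) (hi : Primrec i) (he : Primrec e) :
    Primrec fun a => (c a).entry (i a) (e a) :=
  (Primrec.list_getD _).comp
    ((Primrec.list_getD _).comp (primrec_gameCode_levels.comp hc) hi) he

theorem primrec_automaton (hc : Primrec c) (hi : Primrec i) (he : Primrec e) (ho : Primrec o) :
    Primrec fun a => (c a).automaton (i a) (e a) (o a) :=
  (Primrec.list_getD _).comp (Primrec.snd.comp (primrec_entry hc hi he)) ho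

theorem primrec_levelBound : Primrec levelBound :=
  Primrec.list_length.comp (Primrec.list_flatten.comp primrec_gameCode_levels)

theorem primrec_stateBound : Primrec stateBound := by
  have h : Primrec fun c : GameCode =>
      (c.levels.flatten.flatMap Prod.snd).map BuchiCode.states :=
    Primrec.list_map (Primrec.list_flatMap (Primrec.list_flatten.comp primrec_gameCode_levels)
      (Primrec.snd.comp Primrec.snd)) (primrec_buchiCode_states.comp Primrec.snd)
  have h' : Primrec fun l : List ℕ => l.sum :=
    (Primrec.list_foldr (h := fun _ q => q.1 + q.2) Primrec.id (Primrec.const 0)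
      ((Primrec.fst.comp Primrec.snd).add (Primrec.snd.comp Primrec.snd))).of_eq fun l => by
        rw [List.sum_eq_foldr]; rfl
  exact h'.comp h

theorem primrec_nodeBound : Primrec nodeBound :=
  (((primrec_gameCode_vertices.mul primrec_gameCode_vertices).mul primrec_gameCode_players).mul
    (primrec_levelBound.pow primrec_gameCode_players)).mul
    (primrec_stateBound.pow primrec_gameCode_players)

theorem primrec_base : Primrec base :=
  ((((primrec_nodeBound.add primrec_gameCode_players).add primrec_gameCode_vertices).add
    primrec_levelBound).add primrec_stateBound).add (Primrec.const 1)

theorem primrec_tablesBound : Primrec tablesBound :=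
  primrec_base.pow ((Primrec.const 7).mul (primrec_base.mul primrec_base))

theorem primrec_digit {b t : α → ℕ} (hb : Primrec b) (hn : Primrec n) (ht : Primrec t) :
    Primrec fun a => digit (b a) (n a) (t a) :=
  Primrec.nat_mod.comp (Primrec.nat_div.comp hn (hb.pow ht)) hb

theorem primrec_table (hc : Primrec c) (hn : Primrec n) (j : ℕ) (hx : Primrec x)
    (hi : Primrec i) : Primrec fun a => (c a).table (n a) j (x a) (i a) :=
  primrec_digit (primrec_base.comp hc) hn ((Primrec.const j).add ((Primrec.const 7).mul
    (hi.add ((primrec_base.comp hc).mul hx))))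

theorem primrecPred_ratCode_le {f g : α → RatCode} (hf : Primrec f) (hg : Primrec g) :
    PrimrecPred fun a => (f a).Le (g a) :=
  PrimrecPred.le
    (((primrec_ratCode_pos.comp hf).mul ((primrec_ratCode_den.comp hg).add (.const 1))).add
      ((primrec_ratCode_neg.comp hg).mul ((primrec_ratCode_den.comp hf).add (.const 1))))
    (((primrec_ratCode_pos.comp hg).mul ((primrec_ratCode_den.comp hf).add (.const 1))).add
      ((primrec_ratCode_neg.comp hf).mul ((primrec_ratCode_den.comp hg).add (.const 1))))

end

/-! The seven tables. -/

/-- The current vertex of a node. -/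
def vert (c : GameCode) (n x : ℕ) : ℕ := c.table n 0 x 0
/-- The vertex in which the current play starts. -/
def origin (c : GameCode) (n x : ℕ) : ℕ := c.table n 1 x 0
/-- The next vertex. -/
def out (c : GameCode) (n x : ℕ) : ℕ := c.table n 2 x 0
/-- The index of the cost for player `i`. -/
def level (c : GameCode) (n x i : ℕ) : ℕ := c.table n 3 x i
/-- The current state of the automaton of player `i`. -/
def autState (c : GameCode) (n x i : ℕ) : ℕ := c.table n 4 x i
/-- The update function. -/
def upd (c : GameCode) (n x v : ℕ) : ℕ := c.table n 5 x v
/-- The initial node. -/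
def initNode (c : GameCode) (n : ℕ) : ℕ := c.table n 6 0 0

/-- The automaton of player `i` at node `x`. -/
def nodeAut (c : GameCode) (n x i : ℕ) : BuchiCode :=
  c.automaton i (c.level n x i) (c.origin n x)

/-- The cost of player `i` at node `x`. -/
def nodeRat (c : GameCode) (n x i : ℕ) : RatCode := (c.entry i (c.level n x i)).1

/-- Automaton runs begin here. The bound by `states` makes the stored number an actual state. -/
def StartNode (c : GameCode) (n x : ℕ) : Prop :=
  c.origin n x = c.vert n x ∧ ∀ i < c.players,
    c.autState n x i < (c.nodeAut n x i).states ∧ c.autState n x i ∈ (c.nodeAut n x i).start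

/-- Origin and levels are frozen along a play, so that each player keeps reading with one automaton.
-/
def StepNode (c : GameCode) (n x y : ℕ) : Prop :=
  c.origin n y = c.origin n x ∧ ∀ i < c.players, c.level n y i = c.level n x i ∧
    c.autState n y i < (c.nodeAut n x i).states ∧
    (c.autState n x i, c.vert n x, c.autState n y i) ∈ (c.nodeAut n x i).trans

/-- The bound on `upd` is required even off the edges, to keep the update total on nodes. Costs are
compared only at departures, since a step along the output preserves the levels. -/
def UpdNode (c : GameCode) (n x v : ℕ) : Prop :=
  c.upd n x v < c.nodeBound ∧ ((c.vert n x, v) ∈ c.edges → c.vert n (c.upd n x v) = v ∧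
    (v = c.out n x → c.StepNode n x (c.upd n x v)) ∧
    (v ≠ c.out n x → c.StartNode n (c.upd n x v) ∧
      (c.nodeRat n x (c.owner.getD (c.vert n x) 0)).Le
        (c.nodeRat n (c.upd n x v) (c.owner.getD (c.vert n x) 0))))

def GoodNode (c : GameCode) (n x : ℕ) : Prop :=
  c.vert n x < c.vertices ∧ c.out n x < c.vertices ∧ (c.vert n x, c.out n x) ∈ c.edges ∧
    ∀ v < c.vertices, c.UpdNode n x v

/-- Every nonempty set of nodes (the set of positions of the digits `1` of `t`) that is closed
under following the output contains an accepting node for player `i`. -/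
def Accepting (c : GameCode) (n i : ℕ) : Prop :=
  ∀ t < 2 ^ c.nodeBound, (∃ x < c.nodeBound, digit 2 t x = 1) →
    (∀ x < c.nodeBound, digit 2 t x = 1 → digit 2 t (c.upd n x (c.out n x)) = 1) →
    ∃ x < c.nodeBound, digit 2 t x = 1 ∧ c.autState n x i ∈ (c.nodeAut n x i).accept

/-- The tables coded by `n` form an equilibrium machine. -/
def Certifies (c : GameCode) (n : ℕ) : Prop :=
  (c.initNode n < c.nodeBound ∧ c.vert n (c.initNode n) = c.init ∧
    c.StartNode n (c.initNode n)) ∧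
  (∀ x < c.nodeBound, c.GoodNode n x) ∧ ∀ i < c.players, c.Accepting n i

def MeetsBounds (c : GameCode) (b : List RatCode) (n : ℕ) : Prop :=
  ∀ i < c.players, (c.nodeRat n (c.initNode n) i).Le (b.getD i default)

/-! ### Verification of certificates is primitive recursive -/

section

variable {α : Type*} [Primcodable α] {c : α → GameCode} {n x y i v : α → ℕ}

theorem primrec_vert (hc : Primrec c) (hn : Primrec n) (hx : Primrec x) :
    Primrec fun a => (c a).vert (n a) (x a) := primrec_table hc hn 0 hx (.const 0)

theorem primrec_origin (hc : Primrec c) (hn : Primrec n) (hx : Primrec x) :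
    Primrec fun a => (c a).origin (n a) (x a) := primrec_table hc hn 1 hx (.const 0)

theorem primrec_out (hc : Primrec c) (hn : Primrec n) (hx : Primrec x) :
    Primrec fun a => (c a).out (n a) (x a) := primrec_table hc hn 2 hx (.const 0)

theorem primrec_level (hc : Primrec c) (hn : Primrec n) (hx : Primrec x) (hi : Primrec i) :
    Primrec fun a => (c a).level (n a) (x a) (i a) := primrec_table hc hn 3 hx hi

theorem primrec_autState (hc : Primrec c) (hn : Primrec n) (hx : Primrec x) (hi : Primrec i) :
    Primrec fun a => (c a).autState (n a) (x a) (i a) := primrec_table hc hn 4 hx hi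

theorem primrec_upd (hc : Primrec c) (hn : Primrec n) (hx : Primrec x) (hv : Primrec v) :
    Primrec fun a => (c a).upd (n a) (x a) (v a) := primrec_table hc hn 5 hx hv

theorem primrec_initNode (hc : Primrec c) (hn : Primrec n) :
    Primrec fun a => (c a).initNode (n a) := primrec_table hc hn 6 (.const 0) (.const 0)

theorem primrec_nodeAut (hc : Primrec c) (hn : Primrec n) (hx : Primrec x) (hi : Primrec i) :
    Primrec fun a => (c a).nodeAut (n a) (x a) (i a) :=
  primrec_automaton hc hi (primrec_level hc hn hx hi) (primrec_origin hc hn hx)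

theorem primrec_nodeRat (hc : Primrec c) (hn : Primrec n) (hx : Primrec x) (hi : Primrec i) :
    Primrec fun a => (c a).nodeRat (n a) (x a) (i a) :=
  Primrec.fst.comp (primrec_entry hc hi (primrec_level hc hn hx hi))

theorem primrecPred_startNode (hc : Primrec c) (hn : Primrec n) (hx : Primrec x) :
    PrimrecPred fun a => (c a).StartNode (n a) (x a) := by
  refine (PrimrecPred.eq (primrec_origin hc hn hx) (primrec_vert hc hn hx)).and
    (PrimrecPred.forall_lt_apply (primrec_gameCode_players.comp hc) ?_)
  have hc := hc.comp (Primrec.fst (α := α) (β := ℕ))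
  have hn := hn.comp (Primrec.fst (α := α) (β := ℕ))
  have hx := hx.comp (Primrec.fst (α := α) (β := ℕ))
  have hi := Primrec.snd (α := α) (β := ℕ)
  have hA := primrec_nodeAut hc hn hx hi
  have hs := primrec_autState hc hn hx hi
  exact (PrimrecPred.lt hs (primrec_buchiCode_states.comp hA)).and
    (PrimrecPred.mem_list hs (primrec_buchiCode_start.comp hA))

theorem primrecPred_stepNode (hc : Primrec c) (hn : Primrec n) (hx : Primrec x)
    (hy : Primrec y) : PrimrecPred fun a => (c a).StepNode (n a) (x a) (y a) := by
  refine (PrimrecPred.eq (primrec_origin hc hn hy) (primrec_origin hc hn hx)).and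
    (PrimrecPred.forall_lt_apply (primrec_gameCode_players.comp hc) ?_)
  have hc := hc.comp (Primrec.fst (α := α) (β := ℕ))
  have hn := hn.comp (Primrec.fst (α := α) (β := ℕ))
  have hx := hx.comp (Primrec.fst (α := α) (β := ℕ))
  have hy := hy.comp (Primrec.fst (α := α) (β := ℕ))
  have hi := Primrec.snd (α := α) (β := ℕ)
  have hA := primrec_nodeAut hc hn hx hi
  have hs := primrec_autState hc hn hx hi
  have ht := primrec_autState hc hn hy hi
  exact (PrimrecPred.eq (primrec_level hc hn hy hi) (primrec_level hc hn hx hi)).and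
    ((PrimrecPred.lt ht (primrec_buchiCode_states.comp hA)).and
    (PrimrecPred.mem_list (hs.pair ((primrec_vert hc hn hx).pair ht))
      (primrec_buchiCode_trans.comp hA)))

theorem primrecPred_updNode (hc : Primrec c) (hn : Primrec n) (hx : Primrec x)
    (hv : Primrec v) : PrimrecPred fun a => (c a).UpdNode (n a) (x a) (v a) := by
  have hu := primrec_upd hc hn hx hv
  have hw := primrec_vert hc hn hx
  have ho : Primrec fun a => (c a).owner.getD ((c a).vert (n a) (x a)) 0 :=
    (Primrec.list_getD 0).comp (primrec_gameCode_owner.comp hc) hw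
  have he := PrimrecPred.eq hv (primrec_out hc hn hx)
  exact (PrimrecPred.lt hu (primrec_nodeBound.comp hc)).and
    (PrimrecPred.imp (PrimrecPred.mem_list (hw.pair hv) (primrec_gameCode_edges.comp hc))
      ((PrimrecPred.eq (primrec_vert hc hn hu) hv).and
        ((he.imp (primrecPred_stepNode hc hn hx hu)).and
          (he.not.imp ((primrecPred_startNode hc hn hu).and
            (primrecPred_ratCode_le (primrec_nodeRat hc hn hx ho)
              (primrec_nodeRat hc hn hu ho)))))))

theorem primrecPred_goodNode (hc : Primrec c) (hn : Primrec n) (hx : Primrec x) :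
    PrimrecPred fun a => (c a).GoodNode (n a) (x a) := by
  have hV := primrec_gameCode_vertices.comp hc
  have hw := primrec_vert hc hn hx
  have ho := primrec_out hc hn hx
  exact (PrimrecPred.lt hw hV).and ((PrimrecPred.lt ho hV).and
    ((PrimrecPred.mem_list (hw.pair ho) (primrec_gameCode_edges.comp hc)).and
      (PrimrecPred.forall_lt_apply hV (primrecPred_updNode (hc.comp Primrec.fst)
        (hn.comp Primrec.fst) (hx.comp Primrec.fst) Primrec.snd))))

theorem primrecPred_accepting (hc : Primrec c) (hn : Primrec n) (hi : Primrec i) :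
    PrimrecPred fun a => (c a).Accepting (n a) (i a) := by
  refine PrimrecPred.forall_lt_apply
    ((Primrec.const 2).pow (primrec_nodeBound.comp hc)) ?_
  have hN := primrec_nodeBound.comp (hc.comp (Primrec.fst (α := α) (β := ℕ)))
  have hc := hc.comp ((Primrec.fst (α := α) (β := ℕ)).comp (Primrec.fst (β := ℕ)))
  have hn := hn.comp ((Primrec.fst (α := α) (β := ℕ)).comp (Primrec.fst (β := ℕ)))
  have hi := hi.comp ((Primrec.fst (α := α) (β := ℕ)).comp (Primrec.fst (β := ℕ)))
  have ht := (Primrec.snd (α := α) (β := ℕ)).comp (Primrec.fst (β := ℕ))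
  have hx := Primrec.snd (α := α × ℕ) (β := ℕ)
  have h1 : PrimrecPred fun q : (α × ℕ) × ℕ => digit 2 q.1.2 q.2 = 1 :=
    PrimrecPred.eq (primrec_digit (.const 2) ht hx) (.const 1)
  exact (PrimrecPred.exists_lt_apply hN h1).imp ((PrimrecPred.forall_lt_apply hN
    (h1.imp (PrimrecPred.eq (primrec_digit (.const 2) ht
      (primrec_upd hc hn hx (primrec_out hc hn hx))) (.const 1)))).imp
    (PrimrecPred.exists_lt_apply hN (h1.and
      (PrimrecPred.mem_list (primrec_autState hc hn hx hi)
        (primrec_buchiCode_accept.comp (primrec_nodeAut hc hn hx hi))))))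

theorem primrecPred_certifies (hc : Primrec c) (hn : Primrec n) :
    PrimrecPred fun a => (c a).Certifies (n a) := by
  have hN := primrec_nodeBound.comp hc
  have h0 := primrec_initNode hc hn
  exact ((PrimrecPred.lt h0 hN).and ((PrimrecPred.eq (primrec_vert hc hn h0)
    (primrec_gameCode_init.comp hc)).and (primrecPred_startNode hc hn h0))).and
    ((PrimrecPred.forall_lt_apply hN (primrecPred_goodNode (hc.comp Primrec.fst)
      (hn.comp Primrec.fst) Primrec.snd)).and
    (PrimrecPred.forall_lt_apply (primrec_gameCode_players.comp hc)
      (primrecPred_accepting (hc.comp Primrec.fst) (hn.comp Primrec.fst) Primrec.snd)))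

theorem primrecPred_meetsBounds {b : α → List RatCode} (hc : Primrec c) (hb : Primrec b)
    (hn : Primrec n) : PrimrecPred fun a => (c a).MeetsBounds (b a) (n a) := by
  refine PrimrecPred.forall_lt_apply (primrec_gameCode_players.comp hc) ?_
  have hc := hc.comp (Primrec.fst (α := α) (β := ℕ))
  have hn := hn.comp (Primrec.fst (α := α) (β := ℕ))
  exact primrecPred_ratCode_le (primrec_nodeRat hc hn (primrec_initNode hc hn) Primrec.snd)
    ((Primrec.list_getD _).comp (hb.comp Primrec.fst) Primrec.snd)

end

/-- The code of the machine given by the tables. The last state is the initial one: it reads the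
initial vertex. -/
def moore (c : GameCode) (n : ℕ) : MooreCode where
  states := c.nodeBound + 1
  init := c.nodeBound
  update := (List.range (c.nodeBound + 1)).map fun x =>
    (List.range c.vertices).map fun v =>
      if x < c.nodeBound then c.upd n x v else c.initNode n
  output := (List.range (c.nodeBound + 1)).map fun x =>
    if x < c.nodeBound then c.out n x else 0

/-- One copy of the machine for each player. -/
def mooreList (c : GameCode) (n : ℕ) : List MooreCode :=
  (List.range c.players).map fun _ => c.moore n

theorem primrec_mooreList {α : Type*} [Primcodable α] {c : α → GameCode} {n : α → ℕ}
    (hc : Primrec c) (hn : Primrec n) : Primrec fun a => (c a).mooreList (n a) := by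
  have hN := primrec_nodeBound.comp hc
  have hM : Primrec fun a => (c a).moore (n a) := by
    refine primrec_mooreCode_mk (hN.add (.const 1)) hN ?_ ?_
    · refine Primrec.list_map (Primrec.list_range.comp (hN.add (.const 1))) ?_
      refine Primrec.list_map (Primrec.list_range.comp
        (primrec_gameCode_vertices.comp (hc.comp Primrec.fst))) ?_
      have hc := hc.comp ((Primrec.fst (α := α) (β := ℕ)).comp (Primrec.fst (β := ℕ)))
      have hn := hn.comp ((Primrec.fst (α := α) (β := ℕ)).comp (Primrec.fst (β := ℕ)))
      have hx := (Primrec.snd (α := α) (β := ℕ)).comp (Primrec.fst (β := ℕ))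
      exact Primrec.ite (PrimrecPred.lt hx (primrec_nodeBound.comp hc))
        (primrec_upd hc hn hx Primrec.snd) (primrec_initNode hc hn)
    · refine Primrec.list_map (Primrec.list_range.comp (hN.add (.const 1))) ?_
      have hc := hc.comp (Primrec.fst (α := α) (β := ℕ))
      have hn := hn.comp (Primrec.fst (α := α) (β := ℕ))
      exact Primrec.ite (PrimrecPred.lt Primrec.snd (primrec_nodeBound.comp hc))
        (primrec_out hc hn Primrec.snd) (.const 0)
  exact Primrec.list_map (Primrec.list_range.comp (primrec_gameCode_players.comp hc))
    (hM.comp Primrec.fst)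

end GameCode

/-- Bounded search: one can decide whether there is a witness below a bound, and compute one. -/
theorem exists_computable_search {α β : Type*} [Primcodable α] [Primcodable β] {f : α → ℕ}
    {p : α → ℕ → Prop} {g : α → ℕ → β} (hf : Primrec f)
    (hp : PrimrecPred fun q : α × ℕ => p q.1 q.2) (hg : Primrec fun q : α × ℕ => g q.1 q.2) :
    ∃ (decide : α → Bool) (build : α → β), Computable decide ∧ Computable build ∧
      ∀ a, (decide a = true ↔ ∃ n < f a, p a n) ∧
        ((∃ n < f a, p a n) → ∃ n, p a n ∧ build a = g a n) := by
  classical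
  obtain ⟨_, hd⟩ := PrimrecPred.exists_lt_apply hf hp
  -- `Nat.findGreatest` also tries `f a` itself, so the witness found need not lie below the bound.
  -- Certificates are sound whatever their size.
  refine ⟨_, fun a => g a (Nat.findGreatest (p a) (f a)), hd.to_comp,
    (hg.comp (Primrec.id.pair (Primrec.nat_findGreatest hf hp))).to_comp, fun a => ⟨by simp, ?_⟩⟩
  rintro ⟨n, hn, hpn⟩
  exact ⟨_, Nat.findGreatest_spec hn.le hpn, rfl⟩

end Codes

/-! ## Codes of games -/

namespace GameCode.Presents

variable {P V : Type*} {G : QuantGame P V} {v₀ : V} {c : GameCode} {π : P ≃ Fin c.players}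
  {ν : V ≃ Fin c.vertices}

theorem owner_getD (hc : c.Presents G v₀ π ν) (v : V) :
    c.owner.getD (ν v) 0 = π (G.owner v) := by
  simp [List.getD, hc.owner v]

theorem entry_eq {i : P} {l : List (RatCode × List BuchiCode)}
    (hl : c.levels[(π i : ℕ)]? = some l) (e : ℕ) : c.entry (π i) e = l.getD e (default, []) := by
  simp [entry, List.getD, hl]

/-- The automata in the code that have an initial state recognize level sets. -/
theorem levelSet_eq (hc : c.Presents G v₀ π ν) {i : P} {e s : ℕ} {o : V}
    (hs : s ∈ (c.automaton (π i) e (ν o)).start) :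
    G.levelSet i (ratCost (c.entry (π i) e).1.value) o =
      {w | BuchiAccepts ((c.automaton (π i) e (ν o)).toNFA fun u => (ν u : ℕ)) w} := by
  obtain ⟨l, hl, -, h⟩ := hc.levels i
  rw [automaton, entry_eq hl] at hs
  rw [automaton, entry_eq hl]
  by_cases he : e < l.length
  · rw [List.getD_eq_getElem _ _ he]
    obtain ⟨b, hb, hb'⟩ := h l[e] (List.getElem_mem he) o
    have hA : l[e].2.getD (ν o) default = b := by simp [List.getD, hb]
    rw [hA, hb']
  · rw [List.getD_eq_default _ _ (not_lt.1 he)] at hs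
    simp [default] at hs

theorem exists_level (hc : c.Presents G v₀ π ν) {i : P} {x : WithTop ℝ} (hx : x ∈ G.costRange i)
    (v : V) : ∃ e < c.levelBound, ratCost (c.entry (π i) e).1.value = x ∧
      (c.automaton (π i) e (ν v)).states ≤ c.stateBound ∧
      G.levelSet i x v =
        {w | BuchiAccepts ((c.automaton (π i) e (ν v)).toNFA fun u => (ν u : ℕ)) w} := by
  obtain ⟨l, hl, h1, h2⟩ := hc.levels i
  obtain ⟨y, hy, rfl⟩ := h1 x hx
  obtain ⟨b, hb, hb'⟩ := h2 y hy v
  obtain ⟨e, he, rfl⟩ := List.getElem_of_mem hy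
  have hlm : l ∈ c.levels := List.mem_of_getElem? hl
  have hey : c.entry (π i) e = l[e] := by rw [entry_eq hl, List.getD_eq_getElem _ _ he]
  have hA : c.automaton (π i) e (ν v) = b := by
    rw [automaton, hey]; simp [List.getD, hb]
  refine ⟨e, he.trans_le (List.sublist_flatten_of_mem hlm).length_le, by rw [hey], ?_,
    by rw [hA, hb']⟩
  rw [hA]
  refine List.single_le_sum (by simp) _ (List.mem_map_of_mem (List.mem_flatMap.2 ⟨l[e], ?_, ?_⟩))
  · exact List.mem_flatten.2 ⟨l, hlm, hy⟩
  · exact List.mem_of_getElem? hb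

end GameCode.Presents

/-! ## Certified machines are equilibria -/

namespace GameCode.Certifies

variable {P V : Type*} {G : QuantGame P V} {v₀ : V} {c : GameCode} {π : P ≃ Fin c.players}
  {ν : V ≃ Fin c.vertices} {n : ℕ}

theorem node (hn : c.Certifies n) (x : Fin c.nodeBound) : c.GoodNode n x := hn.2.1 x x.2

def vertex (ν : V ≃ Fin c.vertices) (hn : c.Certifies n) (x : Fin c.nodeBound) : V :=
  ν.symm ⟨c.vert n x, (hn.node x).1⟩

def output (ν : V ≃ Fin c.vertices) (hn : c.Certifies n) (x : Fin c.nodeBound) : V :=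
  ν.symm ⟨c.out n x, (hn.node x).2.1⟩

def update (ν : V ≃ Fin c.vertices) (hn : c.Certifies n) (x : Fin c.nodeBound) (v : V) :
    Fin c.nodeBound := ⟨c.upd n x (ν v), ((hn.node x).2.2.2 _ (ν v).2).1⟩

def next (ν : V ≃ Fin c.vertices) (hn : c.Certifies n) (x : Fin c.nodeBound) : Fin c.nodeBound :=
  hn.update ν x (hn.output ν x)

theorem val_vertex (hn : c.Certifies n) (x : Fin c.nodeBound) :
    (ν (hn.vertex ν x) : ℕ) = c.vert n x := by simp [vertex]

theorem val_output (hn : c.Certifies n) (x : Fin c.nodeBound) :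
    (ν (hn.output ν x) : ℕ) = c.out n x := by simp [output]

theorem val_next (hn : c.Certifies n) (x : Fin c.nodeBound) :
    (hn.next ν x : ℕ) = c.upd n x (c.out n x) := by
  simp [next, update, val_output]

theorem edge_output (hc : c.Presents G v₀ π ν) (hn : c.Certifies n) (x : Fin c.nodeBound) :
    G.edge (hn.vertex ν x) (hn.output ν x) := by
  rw [hc.edge, val_vertex, val_output]; exact (hn.node x).2.2.1

theorem updNode (hc : c.Presents G v₀ π ν) (hn : c.Certifies n) {x : Fin c.nodeBound} {v : V}
    (h : G.edge (hn.vertex ν x) v) : c.vert n (hn.update ν x v) = ν v ∧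
      (v = hn.output ν x → c.StepNode n x (hn.update ν x v)) ∧
      (v ≠ hn.output ν x → c.StartNode n (hn.update ν x v) ∧
        (c.nodeRat n x (π (G.owner (hn.vertex ν x)))).Le
          (c.nodeRat n (hn.update ν x v) (π (G.owner (hn.vertex ν x))))) := by
  have hiff : v = hn.output ν x ↔ (ν v : ℕ) = c.out n x := by
    rw [← val_output (ν := ν) hn, Fin.val_inj, ν.apply_eq_iff_eq]
  have := ((hn.node x).2.2.2 _ (ν v).2).2 (by rw [← hn.val_vertex (ν := ν), ← hc.edge]; exact h)
  rw [← hn.val_vertex (ν := ν), hc.owner_getD] at this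
  rw [Ne, hiff]
  exact this

theorem stepNode_next (hc : c.Presents G v₀ π ν) (hn : c.Certifies n) (x : Fin c.nodeBound) :
    c.StepNode n x (hn.next ν x) :=
  (hn.updNode hc (hn.edge_output hc x)).2.1 rfl

/-- The orbit of `x` is a nonempty set of nodes closed under the output, so `Accepting` applies to
the number `t` that codes it. -/
theorem exists_accept (ν : V ≃ Fin c.vertices) (hn : c.Certifies n) (x : Fin c.nodeBound)
    {i : ℕ} (hi : i < c.players) : ∃ m, c.autState n ((hn.next ν)^[m] x) i ∈
      (c.nodeAut n ((hn.next ν)^[m] x) i).accept := by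
  classical
  let f : ℕ → ℕ := fun y => if ∃ m, ((hn.next ν)^[m] x : ℕ) = y then 1 else 0
  have hf : ∀ y, f y = 1 ↔ ∃ m, ((hn.next ν)^[m] x : ℕ) = y := fun y => by
    simp only [f]; split <;> simp_all
  obtain ⟨t, ht, htf⟩ := exists_digit_eq (b := 2) (l := c.nodeBound) (f := f)
    (fun y _ => by simp only [f]; split <;> omega)
  obtain ⟨y, hy, hy1, hacc⟩ := hn.2.2 i hi t ht
    ⟨x, x.2, by rw [htf x x.2, hf]; exact ⟨0, rfl⟩⟩ (fun y hy h1 => by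
      rw [htf y hy, hf] at h1
      obtain ⟨m, rfl⟩ := h1
      rw [← val_next (ν := ν) hn, ← Function.iterate_succ_apply' (hn.next ν), htf _ (Fin.isLt _), hf]
      exact ⟨_, rfl⟩)
  rw [htf y hy, hf] at hy1
  obtain ⟨m, rfl⟩ := hy1
  exact ⟨m, hacc⟩

theorem iterate_next (hc : c.Presents G v₀ π ν) (hn : c.Certifies n) (x : Fin c.nodeBound)
    (m : ℕ) : c.origin n ((hn.next ν)^[m] x) = c.origin n x ∧
      ∀ i < c.players, c.level n ((hn.next ν)^[m] x) i = c.level n x i := by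
  induction m with
  | zero => exact ⟨rfl, fun _ _ => rfl⟩
  | succ m ih =>
    rw [Function.iterate_succ_apply']
    have := hn.stepNode_next hc ((hn.next ν)^[m] x)
    exact ⟨this.1.trans ih.1, fun i hi => (this.2 i hi).1.trans (ih.2 i hi)⟩

/-- The stored automaton states form an accepting run on the orbit. The automaton recognizes the
plays from the origin with the labelled cost, and at a start node the origin is the current vertex.
-/
theorem cost_orbit (hc : c.Presents G v₀ π ν) (hn : c.Certifies n) {x : Fin c.nodeBound}
    (hx : c.StartNode n x) (i : P) : G.cost i (fun m => hn.vertex ν ((hn.next ν)^[m] x)) =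
      ratCost (c.nodeRat n x (π i)).value := by
  have hA : ∀ m, c.nodeAut n ((hn.next ν)^[m] x) (π i) = c.nodeAut n x (π i) := fun m => by
    rw [nodeAut, (hn.iterate_next hc x m).1, (hn.iterate_next hc x m).2 _ (π i).2]; rfl
  have hst : ∀ m, c.autState n ((hn.next ν)^[m] x) (π i) < (c.nodeAut n x (π i)).states := by
    intro m
    cases m with
    | zero => exact (hx.2 _ (π i).2).1
    | succ m =>
      have := ((hn.stepNode_next hc ((hn.next ν)^[m] x)).2 _ (π i).2).2.1
      rwa [hA, ← Function.iterate_succ_apply' (hn.next ν)] at this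
  have ho : c.origin n x = ν (hn.vertex ν x) := by rw [hx.1, val_vertex]
  have hstart := (hx.2 _ (π i).2).2
  rw [nodeAut, ho] at hstart
  have key : (fun m => hn.vertex ν ((hn.next ν)^[m] x)) ∈
      G.levelSet i (ratCost (c.entry (π i) (c.level n x (π i))).1.value) (hn.vertex ν x) := by
    rw [hc.levelSet_eq hstart, ← ho]
    refine ⟨fun m => ⟨c.autState n ((hn.next ν)^[m] x) (π i), hst m⟩, (hx.2 _ (π i).2).2,
      fun m => ?_, ?_⟩
    · have := ((hn.stepNode_next hc ((hn.next ν)^[m] x)).2 _ (π i).2).2.2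
      rw [hA, ← Function.iterate_succ_apply' (hn.next ν), ← val_vertex (ν := ν) hn] at this
      exact this
    -- Acceptance is available from every node, in particular from the `a`-th iterate.
    · rw [frequently_atTop]
      intro a
      obtain ⟨m, hm⟩ := hn.exists_accept ν ((hn.next ν)^[a] x) (π i).2
      rw [← Function.iterate_add_apply, hA] at hm
      exact ⟨m + a, by omega, hm⟩
  exact key.2.2

/-- The equilibrium machine given by certified tables. -/
noncomputable def eqMachine (hc : c.Presents G v₀ π ν) (hn : c.Certifies n) :
    EqMachine G v₀ (Fin c.nodeBound) where
  init := ⟨c.initNode n, hn.1.1⟩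
  vert := hn.vertex ν
  out := hn.output ν
  upd := hn.update ν
  cost x i := ratCost (c.nodeRat n x (π i)).value
  start x := c.StartNode n x
  vert_init := by
    rw [← ν.apply_eq_iff_eq, ← Fin.val_inj, val_vertex, ← hc.init]; exact hn.1.2.1
  start_init := hn.1.2.2
  edge_out := hn.edge_output hc
  vert_upd x v h := by
    rw [← ν.apply_eq_iff_eq, ← Fin.val_inj, val_vertex]; exact (hn.updNode hc h).1
  cost_next x := by
    funext i
    have := ((hn.stepNode_next hc x).2 _ (π i).2).1
    simp only [nodeRat]
    rw [show c.level n (hn.update ν x (hn.output ν x)) (π i) = c.level n x (π i) from this]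
  cost_deviation x v h := by
    by_cases hv : v = hn.output ν x
    · subst hv
      have := ((hn.stepNode_next hc x).2 _ (π (G.owner (hn.vertex ν x))).2).1
      simp only [nodeRat]
      rw [show c.level n (hn.update ν x (hn.output ν x)) _ = c.level n x _ from this]
    · have := ((hn.updNode hc h).2.2 hv).2
      rw [RatCode.le_iff] at this
      simpa [ratCost] using this
  start_upd x v h hv := ((hn.updNode hc h).2.2 hv).1
  cost_orbit _ hx i := hn.cost_orbit hc hx i

theorem isWeakSPE (hG : ∀ i, G.PrefixIndependent i) (hc : c.Presents G v₀ π ν)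
    (hn : c.Certifies n) : G.IsWeakSPE v₀ (hn.eqMachine hc).strategy :=
  (hn.eqMachine hc).isWeakSPE hG

/-- The machine with an additional initial state. -/
def mooreMachine (ν : V ≃ Fin c.vertices) (v₀ : V) (hn : c.Certifies n) :
    MooreMachine V (Fin (c.nodeBound + 1)) where
  init := Fin.last _
  update s v := if h : (s : ℕ) < c.nodeBound then (hn.update ν ⟨s, h⟩ v).castSucc
    else ⟨c.initNode n, hn.1.1.trans (Nat.lt_succ_self _)⟩
  -- The output of the extra state is never used, as histories are non-empty. Index `0` denotes a
  -- vertex because `v₀` exists.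
  output s := if h : (s : ℕ) < c.nodeBound then hn.output ν ⟨s, h⟩
    else ν.symm ⟨0, (Nat.zero_le _).trans_lt (ν v₀).2⟩

theorem representsProfile (hc : c.Presents G v₀ π ν) (hn : c.Certifies n) :
    RepresentsProfile (c.mooreList n) G v₀ π ν (hn.eqMachine hc).strategy := by
  intro i
  refine ⟨c.moore n, by simp [mooreList], hn.mooreMachine ν v₀, ⟨rfl, ?_, ?_⟩, ?_⟩
  · intro s v
    have hs : (s : ℕ) < c.nodeBound + 1 := s.2
    by_cases h : (s : ℕ) < c.nodeBound
    · simp [moore, mooreMachine, h, hs, update]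
    · simp [moore, mooreMachine, h, hs]
  · intro s
    have hs : (s : ℕ) < c.nodeBound + 1 := s.2
    by_cases h : (s : ℕ) < c.nodeBound
    · simp [moore, mooreMachine, h, hs, output]
    · simp [moore, mooreMachine, h, hs]
  · intro h v _ _
    have hfold : ∀ (t : List V) (x : Fin c.nodeBound),
        t.foldl (hn.mooreMachine ν v₀).update x.castSucc = (t.foldl (hn.update ν) x).castSucc := by
      intro t
      induction t with
      | nil => intro x; rfl
      | cons a t ih =>
        intro x
        rw [List.foldl_cons, List.foldl_cons, ← ih]
        congr 1
        simp [mooreMachine]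
    -- The first letter only leaves the extra initial state. Correspondingly, `EqMachine.state`
    -- skips it.
    obtain ⟨a, t, ht⟩ : ∃ a t, h ++ [v] = a :: t := List.exists_cons_of_ne_nil (by simp)
    have h1 : (hn.mooreMachine ν v₀).update (hn.mooreMachine ν v₀).init a =
        (⟨c.initNode n, hn.1.1⟩ : Fin c.nodeBound).castSucc := by
      simp [mooreMachine]
    show (hn.eqMachine hc).out ((hn.eqMachine hc).state (h ++ [v])) = (hn.mooreMachine ν v₀).output
      ((h ++ [v]).foldl (hn.mooreMachine ν v₀).update (hn.mooreMachine ν v₀).init)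
    rw [ht, List.foldl_cons, h1, hfold, EqMachine.state, List.tail_cons]
    simp only [mooreMachine, eqMachine, Fin.val_castSucc, Fin.is_lt, dite_true, Fin.eta]

end GameCode.Certifies

/-! ## Equilibria yield certified machines -/

namespace GameCode

/-- The position `j + 7 * (i + base * x)` determines `j`, `i` and `x` by division with remainder. -/
theorem exists_tables (c : GameCode) (F : ℕ → ℕ → ℕ → ℕ) (hF : ∀ j x i, F j x i < c.base) :
    ∃ n < c.tablesBound, ∀ j < 7, ∀ x < c.base, ∀ i < c.base, c.table n j x i = F j x i := by
  obtain ⟨n, hn, h⟩ := exists_digit_eq (b := c.base) (l := 7 * (c.base * c.base))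
    (f := fun t => F (t % 7) (t / 7 / c.base) (t / 7 % c.base)) (fun _ _ => hF _ _ _)
  refine ⟨n, hn, fun j hj x hx i hi => ?_⟩
  have h0 : 0 < c.base := by omega
  have hlt : i + c.base * x < c.base * c.base :=
    calc i + c.base * x < c.base + c.base * x := by omega
      _ = c.base * (x + 1) := by ring
      _ ≤ c.base * c.base := Nat.mul_le_mul_left _ hx
  rw [table, h _ (by omega)]
  have h1 : (j + 7 * (i + c.base * x)) % 7 = j := by omega
  have h2 : (j + 7 * (i + c.base * x)) / 7 = i + c.base * x := by omega
  simp only [h1, h2]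
  rw [Nat.add_mul_div_left _ _ h0, Nat.div_eq_of_lt hi, Nat.add_mul_mod_self_left,
    Nat.mod_eq_of_lt hi, Nat.zero_add]

/-- A position in a play together with the states of runs of automata, one for each player. -/
structure Node (c : GameCode) where
  vertex : Fin c.vertices
  origin : Fin c.vertices
  level : Fin c.players → Fin c.levelBound
  state : Fin c.players → Fin c.stateBound

namespace Node

variable {c : GameCode}

def equiv : c.Node ≃ Fin c.vertices × Fin c.vertices × (Fin c.players → Fin c.levelBound) ×
    (Fin c.players → Fin c.stateBound) where
  toFun y := (y.vertex, y.origin, y.level, y.state)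
  invFun y := ⟨y.1, y.2.1, y.2.2.1, y.2.2.2⟩
  left_inv _ := rfl
  right_inv _ := rfl

/-- The automaton of player `i`. -/
def aut (y : c.Node) (i : Fin c.players) : BuchiCode := c.automaton i (y.level i) y.origin

/-- The cost of player `i`. -/
def rat (y : c.Node) (i : Fin c.players) : RatCode := (c.entry i (y.level i)).1

def IsStart (y : c.Node) : Prop :=
  y.origin = y.vertex ∧ ∀ i, (y.state i : ℕ) < (y.aut i).states ∧
    (y.state i : ℕ) ∈ (y.aut i).start

def IsStep (y y' : c.Node) : Prop :=
  ((y.vertex : ℕ), (y'.vertex : ℕ)) ∈ c.edges ∧ y'.origin = y.origin ∧ y'.level = y.level ∧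
    ∀ i, (y'.state i : ℕ) < (y.aut i).states ∧
      ((y.state i : ℕ), (y.vertex : ℕ), (y'.state i : ℕ)) ∈ (y.aut i).trans

end Node

/-- The functions of a machine on a set `A` of nodes can be coded by a number. -/
theorem exists_certifies {c : GameCode} {A : Type*} [Finite A] (hcard : Nat.card A ≤ c.nodeBound)
    (node : A → c.Node) (out : A → Fin c.vertices) (upd : A → Fin c.vertices → A) (a₀ : A)
    (hinit : ((node a₀).vertex : ℕ) = c.init) (hstart : (node a₀).IsStart)
    (hout : ∀ a, (node a).IsStep (node (upd a (out a))) ∧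
      (node (upd a (out a))).vertex = out a)
    (hupd : ∀ a (v : Fin c.vertices), (((node a).vertex : ℕ), (v : ℕ)) ∈ c.edges → v ≠ out a →
      (node (upd a v)).vertex = v ∧ (node (upd a v)).IsStart ∧
      ∀ i : Fin c.players, c.owner.getD (node a).vertex 0 = i →
        ((node a).rat i).Le ((node (upd a v)).rat i))
    (howner : ∀ a, c.owner.getD (node a).vertex 0 < c.players)
    (hacc : ∀ a i, ∃ m, ((node ((fun b => upd b (out b))^[m] a)).state i : ℕ) ∈
      ((node ((fun b => upd b (out b))^[m] a)).aut i).accept) :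
    ∃ n < c.tablesBound, c.Certifies n ∧
      ∀ i : Fin c.players, c.nodeRat n (c.initNode n) i = (node a₀).rat i := by
  classical
  have : Nonempty A := ⟨a₀⟩
  obtain ⟨g, hg⟩ : ∃ g : A → ℕ, Function.Injective g ∧ ∀ a, g a < c.nodeBound :=
    ⟨fun a => Finite.equivFin A a, fun a b h => (Finite.equivFin A).injective (Fin.val_injective h),
      fun a => (Fin.is_lt _).trans_le hcard⟩
  -- `Certifies` constrains all numbers below `nodeBound`. Those outside the range of `g` are
  -- decoded to an arbitrary element of `A`, and so satisfy the same conditions.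
  let f : ℕ → A := Function.invFun g
  have hfg : ∀ a, f (g a) = a := Function.leftInverse_invFun hg.1
  let F : ℕ → ℕ → ℕ → ℕ := fun j x i =>
    if j = 0 then (node (f x)).vertex
    else if j = 1 then (node (f x)).origin
    else if j = 2 then out (f x)
    else if j = 3 then (if h : i < c.players then (node (f x)).level ⟨i, h⟩ else 0)
    else if j = 4 then (if h : i < c.players then (node (f x)).state ⟨i, h⟩ else 0)
    else if j = 5 then (if h : i < c.vertices then g (upd (f x) ⟨i, h⟩) else 0)
    else g a₀
  have hbase : c.base = c.nodeBound + c.players + c.vertices + c.levelBound + c.stateBound + 1 :=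
    rfl
  obtain ⟨n, hn, hT⟩ := c.exists_tables F (by
    intro j x i
    simp only [F]
    split_ifs <;> first
      | omega
      | (have := hg.2 (upd (f x) ⟨i, ‹_›⟩); omega)
      | (have := hg.2 a₀; omega))
  have hvert : ∀ x < c.nodeBound, c.vert n x = (node (f x)).vertex := fun x hx =>
    hT 0 (by omega) x (by omega) 0 (by omega)
  have horigin : ∀ x < c.nodeBound, c.origin n x = (node (f x)).origin := fun x hx =>
    hT 1 (by omega) x (by omega) 0 (by omega)
  have hout' : ∀ x < c.nodeBound, c.out n x = out (f x) := fun x hx =>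
    hT 2 (by omega) x (by omega) 0 (by omega)
  have hlevel : ∀ x < c.nodeBound, ∀ i : Fin c.players, c.level n x i = (node (f x)).level i :=
    fun x hx i => (hT 3 (by omega) x (by omega) i (by omega)).trans (by simp [F])
  have hstate : ∀ x < c.nodeBound, ∀ i : Fin c.players, c.autState n x i = (node (f x)).state i :=
    fun x hx i => (hT 4 (by omega) x (by omega) i (by omega)).trans (by simp [F])
  have hupd' : ∀ x < c.nodeBound, ∀ v : Fin c.vertices, c.upd n x v = g (upd (f x) v) :=
    fun x hx v => (hT 5 (by omega) x (by omega) v (by omega)).trans (by simp [F])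
  have hinit' : c.initNode n = g a₀ := hT 6 (by omega) 0 (by omega) 0 (by omega)
  have haut : ∀ x < c.nodeBound, ∀ i : Fin c.players, c.nodeAut n x i = (node (f x)).aut i :=
    fun x hx i => by rw [nodeAut, hlevel x hx, horigin x hx]; rfl
  have hrat : ∀ x < c.nodeBound, ∀ i : Fin c.players, c.nodeRat n x i = (node (f x)).rat i :=
    fun x hx i => by rw [nodeRat, hlevel x hx]; rfl
  have hS : ∀ x < c.nodeBound, (node (f x)).IsStart → c.StartNode n x := by
    intro x hx h
    refine ⟨by rw [horigin x hx, hvert x hx, h.1], fun i hi => ?_⟩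
    have := h.2 ⟨i, hi⟩
    rwa [← haut x hx, ← hstate x hx] at this
  have hnext : ∀ x < c.nodeBound, c.upd n x (c.out n x) = g (upd (f x) (out (f x))) := by
    intro x hx
    rw [hout' x hx, hupd' x hx]
  refine ⟨n, hn, ⟨⟨?_, ?_, ?_⟩, ?_, ?_⟩, ?_⟩
  · rw [hinit']; exact hg.2 _
  · rw [hinit', hvert _ (hg.2 _), hfg, hinit]
  · rw [hinit']; exact hS _ (hg.2 _) (by rwa [hfg])
  · intro x hx
    obtain ⟨hs, hv⟩ := hout (f x)
    refine ⟨by rw [hvert x hx]; exact Fin.is_lt _, by rw [hout' x hx]; exact Fin.is_lt _, ?_, ?_⟩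
    · rw [hvert x hx, hout' x hx, ← hv]; exact hs.1
    · intro v hv'
      have hu := hupd' x hx ⟨v, hv'⟩
      simp only at hu
      have hlt := hg.2 (upd (f x) ⟨v, hv'⟩)
      refine ⟨hu ▸ hlt, fun he => ?_⟩
      rw [hvert x hx] at he
      rw [hu, hvert _ hlt, hfg, hout' x hx]
      have key : (v = out (f x) → c.StepNode n x (g (upd (f x) ⟨v, hv'⟩))) := by
        intro e
        have e' : (⟨v, hv'⟩ : Fin c.vertices) = out (f x) := Fin.ext e
        rw [e']
        have hlt := hg.2 (upd (f x) (out (f x)))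
        refine ⟨by rw [horigin _ hlt, horigin x hx, hfg, hs.2.1], fun i hi => ?_⟩
        have h1 := hlevel _ hlt ⟨i, hi⟩
        have h2 := hlevel x hx ⟨i, hi⟩
        have h3 := hs.2.2.2 ⟨i, hi⟩
        rw [← haut x hx, ← hstate x hx, ← hvert x hx] at h3
        have h4 := hstate _ hlt ⟨i, hi⟩
        rw [hfg] at h1 h4
        rw [← h4] at h3
        rw [hs.2.2.1] at h1
        exact ⟨h1.trans h2.symm, h3.1, h3.2⟩
      refine ⟨?_, key, fun hne => ?_⟩
      · by_cases e : (⟨v, hv'⟩ : Fin c.vertices) = out (f x)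
        · rw [e, hv, ← e]
        · rw [(hupd _ _ he e).1]
      · obtain ⟨-, h2, h3⟩ := hupd (f x) ⟨v, hv'⟩ he (fun e => hne (congrArg Fin.val e))
        refine ⟨hS _ hlt (by rwa [hfg]), ?_⟩
        rw [hvert x hx]
        have h4 := h3 ⟨_, howner (f x)⟩ rfl
        have h5 := hrat x hx ⟨_, howner (f x)⟩
        have h6 := hrat _ hlt ⟨_, howner (f x)⟩
        rw [hfg] at h6
        rw [← h5, ← h6] at h4
        exact h4
  · rintro i hi t - ⟨x, hx, hxt⟩ hclosed
    obtain ⟨m, hm⟩ := hacc (f x) ⟨i, hi⟩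
    -- Closedness puts a number for each iterate into the set coded by `t`. The starting number `x`
    -- need not be in the range of `g`, hence the formulation through `f`.
    have : ∀ m, ∃ y < c.nodeBound, digit 2 t y = 1 ∧ f y = (fun b => upd b (out b))^[m] (f x) := by
      intro m
      induction m with
      | zero => exact ⟨x, hx, hxt, rfl⟩
      | succ m ih =>
        obtain ⟨y, hy, h1, h2⟩ := ih
        have := hclosed y hy h1
        rw [hnext y hy] at this
        exact ⟨_, hg.2 _, this, by rw [hfg, h2, Function.iterate_succ_apply']⟩
    obtain ⟨y, hy, h1, h2⟩ := this m
    refine ⟨y, hy, h1, ?_⟩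
    rw [← h2, ← haut y hy, ← hstate y hy] at hm
    exact hm
  · intro i
    rw [hinit', hrat _ (hg.2 _), hfg]

section

variable {P V : Type*} {G : QuantGame P V} {v₀ : V} {c : GameCode} {π : P ≃ Fin c.players}
  {ν : V ≃ Fin c.vertices} {σ : P → Move V}

/-- The cost vector of a node. -/
noncomputable def Node.costs (π : P ≃ Fin c.players) (y : c.Node) (i : P) : WithTop ℝ :=
  ratCost (y.rat (π i)).value

/-- The steps between nodes that remain within the cost vectors realized by `σ`. -/
def RealizedStep (G : QuantGame P V) (v₀ : V) (σ : P → Move V) (π : P ≃ Fin c.players)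
    (ν : V ≃ Fin c.vertices) (y y' : c.Node) : Prop :=
  -- It suffices to ask this of the source, since every node of an infinite path is a source.
  y.IsStep y' ∧ G.Realized v₀ σ (ν.symm y.vertex) (y.costs π)

def AcceptingNode (i : Fin c.players) (y : c.Node) : Prop :=
  (y.state i : ℕ) ∈ (y.aut i).accept

/-- A realized vector comes with a play along which it stays realized. Pairing this play with an
accepting run for each player gives a fair path of nodes. -/
theorem exists_start_mem_fairSet (hG : ∀ i, G.PrefixIndependent i) (hc : c.Presents G v₀ π ν)
    (hσ : G.IsWeakSPE v₀ σ) {v : V} {p : P → WithTop ℝ} (hp : G.Realized v₀ σ v p) :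
    ∃ y : c.Node, y ∈ fairSet (RealizedStep G v₀ σ π ν) AcceptingNode ∧ y.IsStart ∧
      y.vertex = ν v ∧ y.costs π = p := by
  obtain ⟨ρ, hρ, h0, hcost, hreal⟩ := hσ.exists_play hG hp
  have hlev : ∀ i : P, ∃ e < c.levelBound, ratCost (c.entry (π i) e).1.value = p i ∧
      (c.automaton (π i) e (ν v)).states ≤ c.stateBound ∧
      BuchiAccepts ((c.automaton (π i) e (ν v)).toNFA fun u => (ν u : ℕ)) ρ := by
    intro i
    obtain ⟨e, he, h1, h2, h3⟩ := hc.exists_level (i := i) (x := p i) ⟨ρ, hρ, hcost i⟩ v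
    have : ρ ∈ G.levelSet i (p i) v := ⟨hρ, h0, hcost i⟩
    rw [h3] at this
    exact ⟨e, he, h1, h2, this⟩
  choose e he hval hst hrun using hlev
  choose r hr0 hrs hra using hrun
  let y : ℕ → c.Node := fun m =>
    { vertex := ν (ρ m)
      origin := ν v
      level := fun i => ⟨e (π.symm i), he _⟩
      state := fun i => ⟨r (π.symm i) m, (Fin.is_lt _).trans_le (hst _)⟩ }
  have haut : ∀ m i, (y m).aut i = c.automaton (π (π.symm i)) (e (π.symm i)) (ν v) := by
    intro m i
    simp only [Node.aut, y, Equiv.apply_symm_apply]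
  have hcosts : ∀ m, (y m).costs π = p := by
    intro m
    funext i
    simp only [Node.costs, Node.rat, y, Equiv.symm_apply_apply]
    exact hval i
  refine ⟨y 0, ⟨y, ⟨fun m => ⟨⟨?_, rfl, rfl, fun i => ?_⟩, ?_⟩, fun i => ?_⟩, rfl⟩,
    ⟨by simp [y, h0], fun i => ?_⟩, by simp [y, h0], hcosts 0⟩
  · exact (hc.edge _ _).1 (hρ m)
  · rw [haut]
    exact ⟨(r (π.symm i) (m + 1)).is_lt, hrs (π.symm i) m⟩
  · rw [hcosts]
    simpa [y] using hreal m
  · refine (hra (π.symm i)).mono fun m hm => ?_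
    rw [AcceptingNode, haut]
    exact hm
  · rw [haut]
    exact ⟨(r (π.symm i) 0).is_lt, hr0 (π.symm i)⟩

/-- The states are the nodes with a fair path, each with a counter. The output follows the
positional choice, and any other edge leads to a start node for the vector supplied by
`exists_deviation`. -/
theorem exists_certifies_of_isWeakSPE (hG : ∀ i, G.PrefixIndependent i)
    (hc : c.Presents G v₀ π ν) (hσ : G.IsWeakSPE v₀ σ) :
    ∃ n < c.tablesBound, c.Certifies n ∧
      ∀ i, ratCost (c.nodeRat n (c.initNode n) (π i)).value = G.cost i (G.outcome σ v₀) := by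
  classical
  -- The owner of `v₀` is a player, so the cyclic counter makes sense.
  have : NeZero c.players := ⟨fun h => (h ▸ π (G.owner v₀)).elim0⟩
  obtain ⟨next, hnext⟩ := exists_positional (RealizedStep G v₀ σ π ν) AcceptingNode
  let A := {z : c.Node × Fin c.players // z.1 ∈ fairSet (RealizedStep G v₀ σ π ν) AcceptingNode}
  let nextA : A → A := fun a => ⟨next a.1, (hnext a.1 a.2).2.1⟩
  have hupd : ∀ (a : A) (v : Fin c.vertices), ∃ b : A, (v = (nextA a).1.1.vertex → b = nextA a) ∧
      (((a.1.1.vertex : ℕ), (v : ℕ)) ∈ c.edges → v ≠ (nextA a).1.1.vertex →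
        b.1.1.vertex = v ∧ b.1.1.IsStart ∧ ∀ i : Fin c.players,
          c.owner.getD a.1.1.vertex 0 = i → (a.1.1.rat i).Le (b.1.1.rat i)) := by
    intro a v
    by_cases hv : v = (nextA a).1.1.vertex
    · exact ⟨nextA a, fun _ => rfl, fun _ h => absurd hv h⟩
    by_cases he : ((a.1.1.vertex : ℕ), (v : ℕ)) ∈ c.edges
    · have hreal := (hnext a.1 a.2).1.2
      have hedge : G.edge (ν.symm a.1.1.vertex) (ν.symm v) := by simpa [hc.edge] using he
      obtain ⟨p', hp', hle⟩ := hσ.exists_deviation hG hreal hedge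
      obtain ⟨y, hy, hys, hyv, hyc⟩ := exists_start_mem_fairSet hG hc hσ hp'
      -- The counter may restart anywhere, because `fairSet` does not involve it.
      refine ⟨⟨(y, 0), hy⟩, fun h => absurd h hv, fun _ _ => ⟨by simp [hyv], hys, fun i hi => ?_⟩⟩
      have ho := hc.owner_getD (ν.symm a.1.1.vertex)
      rw [Equiv.apply_symm_apply] at ho
      rw [ho, Fin.val_inj] at hi
      rw [← hyc, Node.costs, Node.costs, hi] at hle
      rw [RatCode.le_iff]
      simpa [ratCost] using hle
    · exact ⟨a, fun h => absurd h hv, fun h => absurd h he⟩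
  choose upd hupd₁ hupd₂ using hupd
  obtain ⟨y, hy, hys, hyv, hyc⟩ := exists_start_mem_fairSet hG hc hσ
    (QuantGame.realized_init (G := G) v₀ σ)
  have : Fintype c.Node := Fintype.ofEquiv _ Node.equiv.symm
  have hcard : Nat.card A ≤ c.nodeBound := by
    calc Nat.card A ≤ Nat.card (c.Node × Fin c.players) :=
          Nat.card_le_card_of_injective _ Subtype.val_injective
      _ = c.nodeBound := by
          rw [Nat.card_prod, Nat.card_congr Node.equiv, nodeBound]
          simp only [Nat.card_eq_fintype_card, Fintype.card_prod, Fintype.card_fin,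
            Fintype.card_fun]
          ring
  -- Hence the orbits of the machine are iterates of `next`, and these meet all acceptance
  -- conditions.
  have hself : ∀ a, upd a (nextA a).1.1.vertex = nextA a := fun a => hupd₁ a _ rfl
  obtain ⟨n, hn, h1, h2⟩ := exists_certifies (A := A) hcard (fun a => a.1.1)
    (fun a => (nextA a).1.1.vertex) upd ⟨(y, 0), hy⟩ (by simp [hyv, hc.init]) hys
    (fun a => by rw [hself]; exact ⟨(hnext a.1 a.2).1.1, rfl⟩) hupd₂
    (fun a => by
      have := hc.owner_getD (ν.symm a.1.1.vertex)
      rw [Equiv.apply_symm_apply] at this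
      rw [this]
      exact Fin.is_lt _)
    (fun a i => by
      simp only [hself]
      obtain ⟨m, hm⟩ := (hnext a.1 a.2).2.2 i
      have : ∀ m, ((fun b => nextA b)^[m] a).1 = next^[m] a.1 := by
        intro m
        induction m with
        | zero => rfl
        | succ m ih => rw [Function.iterate_succ_apply', Function.iterate_succ_apply', ← ih]
      refine ⟨m, ?_⟩
      rw [this]
      exact hm)
  refine ⟨n, hn, h1, fun i => ?_⟩
  rw [h2 (π i)]
  exact congrFun hyc i

end

end GameCode

/-! ## Every game of the class has a code -/

theorem Set.Finite.exists_list {α : Type*} {s : Set α} (hs : s.Finite) :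
    ∃ l : List α, ∀ a, a ∈ l ↔ a ∈ s :=
  ⟨hs.toFinset.toList, fun a => by simp⟩

theorem RatCode.exists_value_eq (q : ℚ) : ∃ r : RatCode, r.value = q := by
  -- One of the two parts of the numerator vanishes. The denominator is stored minus one.
  refine ⟨⟨q.num.toNat, (-q.num).toNat, q.den - 1⟩, ?_⟩
  have h1 : ((q.num.toNat : ℕ) : ℚ) - ((-q.num).toNat : ℕ) = q.num := by
    have : ((q.num.toNat : ℕ) : ℤ) - ((-q.num).toNat : ℕ) = q.num := by omega
    exact_mod_cast this
  have h2 : ((q.den - 1 : ℕ) : ℚ) + 1 = q.den := by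
    rw [Nat.cast_sub q.den_pos]; simp
  rw [RatCode.value, h1, h2, Rat.num_div_den]

theorem OmegaRegular.exists_buchiCode {V : Type*} [Finite V] {L : Set (ℕ → V)}
    (hL : OmegaRegular L) {m : ℕ} (ν : V ≃ Fin m) :
    ∃ b : BuchiCode, L = {w | BuchiAccepts (b.toNFA fun u => (ν u : ℕ)) w} := by
  obtain ⟨k, M, rfl⟩ := hL
  obtain ⟨ls, hs⟩ := ((Set.toFinite M.start).image Fin.val).exists_list
  obtain ⟨la, ha⟩ := ((Set.toFinite M.accept).image Fin.val).exists_list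
  obtain ⟨lt, ht⟩ := ((Set.toFinite {x : Fin k × V × Fin k | x.2.2 ∈ M.step x.1 x.2.1}).image
    fun x => ((x.1 : ℕ), (ν x.2.1 : ℕ), (x.2.2 : ℕ))).exists_list
  refine ⟨⟨k, ls, la, lt⟩, ?_⟩
  have : BuchiCode.toNFA ⟨k, ls, la, lt⟩ (fun u => (ν u : ℕ)) = M := by
    have h1 : ∀ s : Fin k, (s : ℕ) ∈ ls ↔ s ∈ M.start := fun s => by
      rw [hs]; exact Fin.val_injective.mem_set_image
    have h2 : ∀ s : Fin k, (s : ℕ) ∈ la ↔ s ∈ M.accept := fun s => by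
      rw [ha]; exact Fin.val_injective.mem_set_image
    have h3 : ∀ (s : Fin k) (a : V) (t : Fin k),
        ((s : ℕ), (ν a : ℕ), (t : ℕ)) ∈ lt ↔ t ∈ M.step s a := fun s a t => by
      rw [ht]
      constructor
      · rintro ⟨⟨s', a', t'⟩, h, he⟩
        simp only [Prod.mk.injEq, Fin.val_inj, ν.apply_eq_iff_eq] at he
        obtain ⟨rfl, rfl, rfl⟩ := he
        exact h
      · exact fun h => ⟨(s, a, t), h, rfl⟩
    obtain ⟨step, start, accept⟩ := M
    simp only [BuchiCode.toNFA, NFA.mk.injEq]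
    exact ⟨funext fun s => funext fun a => Set.ext fun t => h3 s a t, Set.ext h1, Set.ext h2⟩
  rw [this]

/-- Listing exactly the attained costs suffices, so automata are needed only where regularity is
assumed. Elsewhere the choices are default values. -/
theorem QuantGame.IsRegularPrefixIndependent.exists_presents {P V : Type*} [Finite P] [Finite V]
    {G : QuantGame P V} (hG : G.IsRegularPrefixIndependent) (v₀ : V) :
    ∃ (c : GameCode) (π : P ≃ Fin c.players) (ν : V ≃ Fin c.vertices), c.Presents G v₀ π ν := by
  let π : P ≃ Fin (Nat.card P) := Finite.equivFin P
  let ν : V ≃ Fin (Nat.card V) := Finite.equivFin V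
  have hq : ∀ (i : P) (x : WithTop ℝ), ∃ r : RatCode,
      x ∈ G.costRange i → x = ratCost r.value := by
    intro i x
    by_cases hx : x ∈ G.costRange i
    · obtain ⟨q, rfl⟩ := hG.rational_range i hx
      obtain ⟨r, rfl⟩ := RatCode.exists_value_eq q
      exact ⟨r, fun _ => rfl⟩
    · exact ⟨default, fun h => absurd h hx⟩
  have hb : ∀ (i : P) (x : WithTop ℝ) (v : V), ∃ b : BuchiCode, x ∈ G.costRange i →
      G.levelSet i x v = {w | BuchiAccepts (b.toNFA fun u => (ν u : ℕ)) w} := by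
    intro i x v
    by_cases hx : x ∈ G.costRange i
    · obtain ⟨b, hb⟩ := (hG.omegaRegular i x hx v).exists_buchiCode ν
      exact ⟨b, fun _ => hb⟩
    · exact ⟨default, fun h => absurd h hx⟩
  have hl : ∀ i : P, ∃ l : List (WithTop ℝ), ∀ x, x ∈ l ↔ x ∈ G.costRange i :=
    fun i => (hG.finite_range i).exists_list
  obtain ⟨edges, he⟩ := ((Set.toFinite {x : V × V | G.edge x.1 x.2}).image
    fun x => ((ν x.1 : ℕ), (ν x.2 : ℕ))).exists_list
  choose q hq using hq
  choose b hb using hb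
  choose l hl using hl
  refine ⟨⟨Nat.card P, Nat.card V, List.ofFn fun v => (π (G.owner (ν.symm v)) : ℕ), edges, ν v₀,
    List.ofFn fun i => (l (π.symm i)).map fun x =>
      (q (π.symm i) x, List.ofFn fun v => b (π.symm i) x (ν.symm v))⟩, π, ν, ?_, ?_, rfl, ?_⟩
  · intro v
    simp
  · intro u v
    rw [he]
    constructor
    · exact fun h => ⟨(u, v), h, rfl⟩
    · rintro ⟨⟨u', v'⟩, h, h'⟩
      simp only [Prod.mk.injEq, Fin.val_inj, ν.apply_eq_iff_eq] at h'
      obtain ⟨rfl, rfl⟩ := h'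
      exact h
  · intro i
    refine ⟨(l i).map fun x => (q i x, List.ofFn fun v => b i x (ν.symm v)), by simp, ?_, ?_⟩
    · intro x hx
      exact ⟨_, List.mem_map_of_mem ((hl i x).2 hx), hq i x hx⟩
    · intro e hel v
      obtain ⟨x, hx, rfl⟩ := List.mem_map.1 hel
      rw [hl] at hx
      exact ⟨b i x v, by simp, by rw [← hq i x hx]; exact hb i x v hx⟩

/-! ### Cost bounds and the main theorem -/

theorem GameCode.meetsBounds_iff {P : Type*}
    {c : GameCode} {π : P ≃ Fin c.players} {b : List RatCode} {q : P → ℚ} {n : ℕ}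
    (hb : RepresentsBounds b π q) : c.MeetsBounds b n ↔
      ∀ i, ratCost (c.nodeRat n (c.initNode n) (π i)).value ≤ ratCost (q i) := by
  have key : ∀ i : P, (c.nodeRat n (c.initNode n) (π i)).Le (b.getD (π i) default) ↔
      ratCost (c.nodeRat n (c.initNode n) (π i)).value ≤ ratCost (q i) := by
    intro i
    obtain ⟨r, hr, hq⟩ := hb i
    have : b.getD (π i) default = r := by simp [List.getD, hr]
    rw [this, RatCode.le_iff, hq]
    simp [ratCost]
  constructor
  · exact fun h i => (key i).1 (h _ (π i).2)
  · intro h i hi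
    have := (key (π.symm ⟨i, hi⟩)).2 (h _)
    simpa using this

theorem theorem5p1 :
    ∃ (decideSPE : GameCode → Bool) (buildSPE : GameCode → List MooreCode)
      (decideBounded : GameCode × List RatCode → Bool)
      (buildBounded : GameCode × List RatCode → List MooreCode),
      Computable decideSPE ∧ Computable buildSPE ∧
      Computable decideBounded ∧ Computable buildBounded ∧
      ∀ {P : Type*} {V : Type*} [Finite P] [Finite V] (G : QuantGame P V) (v₀ : V),
        G.IsRegularPrefixIndependent →
        -- every game of the class can be given to the algorithms
        (∃ (c : GameCode) (π : P ≃ Fin c.players) (ν : V ≃ Fin c.vertices), c.Presents G v₀ π ν) ∧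
        ∀ (c : GameCode) (π : P ≃ Fin c.players) (ν : V ≃ Fin c.vertices), c.Presents G v₀ π ν →
          -- existence of a weak SPE
          (decideSPE c = true ↔ ∃ σ, G.IsWeakSPE v₀ σ) ∧
          ((∃ σ, G.IsWeakSPE v₀ σ) →
            ∃ σ, G.IsWeakSPE v₀ σ ∧ RepresentsProfile (buildSPE c) G v₀ π ν σ) ∧
          -- existence of a weak SPE with bounded costs
          ∀ (q : P → ℚ) (b : List RatCode), RepresentsBounds b π q →
            (decideBounded (c, b) = true ↔
              ∃ σ, G.IsWeakSPE v₀ σ ∧ ∀ i, G.cost i (G.outcome σ v₀) ≤ ratCost (q i)) ∧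
            ((∃ σ, G.IsWeakSPE v₀ σ ∧ ∀ i, G.cost i (G.outcome σ v₀) ≤ ratCost (q i)) →
              ∃ σ, (G.IsWeakSPE v₀ σ ∧ ∀ i, G.cost i (G.outcome σ v₀) ≤ ratCost (q i)) ∧
                RepresentsProfile (buildBounded (c, b)) G v₀ π ν σ) := by
  obtain ⟨d₁, b₁, hd₁, hb₁, h₁⟩ := exists_computable_search
    (f := GameCode.tablesBound) (p := GameCode.Certifies) (g := GameCode.mooreList)
    GameCode.primrec_tablesBound (GameCode.primrecPred_certifies Primrec.fst Primrec.snd)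
    (GameCode.primrec_mooreList Primrec.fst Primrec.snd)
  have hfst := (Primrec.fst (α := GameCode) (β := List RatCode)).comp (Primrec.fst (β := ℕ))
  have hsnd := (Primrec.snd (α := GameCode) (β := List RatCode)).comp (Primrec.fst (β := ℕ))
  obtain ⟨d₂, b₂, hd₂, hb₂, h₂⟩ := exists_computable_search
    (f := fun a : GameCode × List RatCode => a.1.tablesBound)
    (p := fun a n => a.1.Certifies n ∧ a.1.MeetsBounds a.2 n)
    (g := fun a n => a.1.mooreList n)
    (GameCode.primrec_tablesBound.comp Primrec.fst)
    ((GameCode.primrecPred_certifies hfst Primrec.snd).and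
      (GameCode.primrecPred_meetsBounds hfst hsnd Primrec.snd))
    (GameCode.primrec_mooreList hfst Primrec.snd)
  refine ⟨d₁, b₁, d₂, b₂, hd₁, hb₁, hd₂, hb₂, fun {P V} _ _ G v₀ hG => ?_⟩
  refine ⟨hG.exists_presents v₀, fun c π ν hc => ?_⟩
  have hpi := hG.prefixIndependent
  -- Soundness holds for every certificate, and completeness provides one within the search bound.
  have hiff : (∃ n < c.tablesBound, c.Certifies n) ↔ ∃ σ, G.IsWeakSPE v₀ σ := by
    constructor
    · rintro ⟨n, -, hn⟩
      exact ⟨_, hn.isWeakSPE hpi hc⟩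
    · rintro ⟨σ, hσ⟩
      obtain ⟨n, hlt, hn, -⟩ := GameCode.exists_certifies_of_isWeakSPE hpi hc hσ
      exact ⟨n, hlt, hn⟩
  refine ⟨(h₁ c).1.trans hiff, fun hσ => ?_, fun q b hb => ?_⟩
  · obtain ⟨n, hn, e⟩ := (h₁ c).2 (hiff.2 hσ)
    exact ⟨_, hn.isWeakSPE hpi hc, e ▸ hn.representsProfile hc⟩
  have hbound : ∀ n (hn : c.Certifies n), c.MeetsBounds b n →
      ∀ i, G.cost i (G.outcome (hn.eqMachine hc).strategy v₀) ≤ ratCost (q i) := by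
    intro n hn hm i
    rw [(hn.eqMachine hc).cost_outcome hpi]
    exact (GameCode.meetsBounds_iff hb).1 hm i
  have hiff₂ : (∃ n < c.tablesBound, c.Certifies n ∧ c.MeetsBounds b n) ↔
      ∃ σ, G.IsWeakSPE v₀ σ ∧ ∀ i, G.cost i (G.outcome σ v₀) ≤ ratCost (q i) := by
    constructor
    · rintro ⟨n, -, hn, hm⟩
      exact ⟨_, hn.isWeakSPE hpi hc, hbound n hn hm⟩
    · rintro ⟨σ, hσ, hle⟩
      -- The certificate preserves the outcome costs exactly, so any bounds met by `σ` are met by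
      -- the machine.
      obtain ⟨n, hlt, hn, hcost⟩ := GameCode.exists_certifies_of_isWeakSPE hpi hc hσ
      refine ⟨n, hlt, hn, (GameCode.meetsBounds_iff hb).2 fun i => ?_⟩
      rw [hcost]
      exact hle i
  refine ⟨(h₂ (c, b)).1.trans hiff₂, fun hσ => ?_⟩
  obtain ⟨n, ⟨hn, hm⟩, e⟩ := (h₂ (c, b)).2 (hiff₂.2 hσ)
  exact ⟨_, ⟨hn.isWeakSPE hpi hc, hbound n hn hm⟩, e ▸ hn.representsProfile hc⟩
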